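/- Let $X$ be a CAT(0) space. A \emph{reflection} of $X$ is an isometry $r$ of $X$ with $r^2=1$ whose fixed-point set $F_r$ (the \emph{wall} of $r$) has empty interior, such that $X\setminus F_r$ has exactly two connected components, both convex, which are interchanged by $r$. Let $W$ be a \emph{cocompact discrete reflection group} of $X$: a group of isometries of $X$ generated by reflections, acting properly (for all $x\in X$ and $N>0$ the set $\{\gamma\in W : \gamma x\in B(x,N)\}$ is finite), such that every chamber $C$, i.e. every connected component of $X\setminus\bigcup_{r\in R}F_r$ where $R$ is the set of all reflections in $W$, has compact closure and satisfies $\{\gamma\in W : \gamma C=C\}=\{1\}$. Fix a chamber $C$, for $r\in R$ let $X_r^+$ be the component of $X\setminus F_r$ containing $C$, and let $S\subset R$ be minimal with $C=\bigcap_{s\in S}X_s^+$ (that is, $C\ne\bigcap_{s\in S\setminus\{s_0\}}X_s^+$ for every $s_0\in S$). For $T\subset S$ let $W_T=\langle T\rangle$ be the corresponding parabolic subgroup, and let $L(W_T)=\overline{W_Tp}\cap\partial X$ be its limit set, where $p$ is any point of $X$ and the closure is taken in $X\cup\partial X$ with the cone topology. Let $T\subset S$. Then there is a unique subset $\tilde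 T\subset T$ such that $W_{\tilde T}$ is the smallest among the subgroups $W_U$, $U\subset T$, of finite index in $W_T$ (the \emph{essential parabolic subgroup} of $W_T$). Moreover, the limit set $L(W_T)$ is $W$-invariant (i.e. $wL(W_T)=L(W_T)$ for all $w\in W$) if and only if $W=W_{\tilde T}\times W_{S\setminus\tilde T}$, i.e. $W$ is the internal direct product of its subgroups $W_{\tilde T}$ and $W_{S\setminus\tilde T}$. -/

import Mathlib

open scoped NNReal

namespace CatReflection

/-! ### Geodesic spaces, convexity, CAT(0) spaces -/

section Geodesic

variable {X : Type*} [MetricSpace X]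

/-- `ξ`, restricted to `[0, d(x,y)]`, is a geodesic from `x` to `y`
(values of `ξ` outside this interval are irrelevant). -/
def IsGeodesic (ξ : ℝ → X) (x y : X) : Prop :=
  ξ 0 = x ∧ ξ (dist x y) = y ∧
    ∀ s ∈ Set.Icc 0 (dist x y), ∀ t ∈ Set.Icc 0 (dist x y), dist (ξ s) (ξ t) = |s - t|

variable (X) in
/-- `X` is a geodesic space. -/
def IsGeodesicSpace : Prop :=
  ∀ x y : X, ∃ ξ : ℝ → X, IsGeodesic ξ x y

/-- A subset is convex if it contains every geodesic joining two of its points. -/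
def IsGeodesicallyConvex (A : Set X) : Prop :=
  ∀ x ∈ A, ∀ y ∈ A, ∀ ξ : ℝ → X, IsGeodesic ξ x y → ∀ t ∈ Set.Icc 0 (dist x y), ξ t ∈ A

variable (X) in
/-- `X` is a CAT(0) space: a geodesic space in which every geodesic triangle is at least as thin
as its comparison triangle `p' q' r'` in the Euclidean plane. Here `ξ s` and `η t` are points on
two sides of the triangle; `p` is the common vertex of these two sides. -/
def IsCAT0 : Prop :=
  IsGeodesicSpace X ∧
    ∀ (p q r : X) (ξ η : ℝ → X), IsGeodesic ξ p q → IsGeodesic η p r →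
      ∀ p' q' r' : EuclideanSpace ℝ (Fin 2),
        dist p' q' = dist p q → dist p' r' = dist p r → dist q' r' = dist q r →
        ∀ s ∈ Set.Icc 0 (dist p q), ∀ t ∈ Set.Icc 0 (dist p r),
          dist (ξ s) (η t) ≤
            dist (AffineMap.lineMap (k := ℝ) p' q' (s / dist p q))
              (AffineMap.lineMap (k := ℝ) p' r' (t / dist p r))

end Geodesic

/-! ### Reflections, reflection groups, chambers -/

section Reflections

variable {X : Type*} [MetricSpace X]

/-- The fixed-point set (the wall, when `r` is a reflection) of an isometry. -/
def wall (r : X ≃ᵢ X) : Set X := {x | r x = x}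

/-- The set of connected components of a subset. -/
def components (A : Set X) : Set (Set X) := {K | ∃ x ∈ A, K = connectedComponentIn A x}

/-- Reflections of a geodesic space. -/
def IsReflection (r : X ≃ᵢ X) : Prop :=
  r * r = 1 ∧ interior (wall r) = ∅ ∧
    ∃ A B : Set X, A ≠ B ∧ components (wall r)ᶜ = {A, B} ∧
      IsGeodesicallyConvex A ∧ IsGeodesicallyConvex B ∧ r '' A = B ∧ r '' B = A

/-- An isometry group is a reflection group if it is generated by some set of reflections. -/
def IsReflectionGroup (W : Subgroup (X ≃ᵢ X)) : Prop :=
  ∃ A : Set (X ≃ᵢ X), (∀ r ∈ A, IsReflection r) ∧ Subgroup.closure A = W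

/-- The set of all reflections belonging to `W`. -/
def reflections (W : Subgroup (X ≃ᵢ X)) : Set (X ≃ᵢ X) := {r | r ∈ W ∧ IsReflection r}

/-- The action of `W` is proper. -/
def IsProperAction (W : Subgroup (X ≃ᵢ X)) : Prop :=
  ∀ (x : X) (N : ℝ), 0 < N → {γ : X ≃ᵢ X | γ ∈ W ∧ γ x ∈ Metric.ball x N}.Finite

/-- The complement of all the walls of `W`. -/
def wallComplement (W : Subgroup (X ≃ᵢ X)) : Set X := (⋃ r ∈ reflections W, wall r)ᶜ

/-- The chamber of `W` containing the point `x₀` (for `x₀` on no wall). -/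
def chamber (W : Subgroup (X ≃ᵢ X)) (x₀ : X) : Set X := connectedComponentIn (wallComplement W) x₀

/-- Cocompact discrete reflection groups. -/
def IsCocompactDiscreteReflectionGroup (W : Subgroup (X ≃ᵢ X)) : Prop :=
  IsReflectionGroup W ∧ IsProperAction W ∧
    ∀ C ∈ components (wallComplement W),
      IsCompact (closure C) ∧ ∀ γ ∈ W, γ '' C = C → γ = 1

/-- The side `X_r⁺` of the wall of `r`, i.e. the component of the complement of the wall which
contains the basepoint `x₀`. -/
def positiveSide (x₀ : X) (r : X ≃ᵢ X) : Set X := connectedComponentIn (wall r)ᶜ x₀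

/-- `S` is a minimal set of reflections in `W` such that the chamber `C` of `x₀` is the
intersection of the `X_s⁺`, `s ∈ S`. -/
def IsFundamentalSet (W : Subgroup (X ≃ᵢ X)) (x₀ : X) (S : Set (X ≃ᵢ X)) : Prop :=
  S ⊆ reflections W ∧ chamber W x₀ = ⋂ s ∈ S, positiveSide x₀ s ∧
    ∀ s₀ ∈ S, chamber W x₀ ≠ ⋂ s ∈ S \ {s₀}, positiveSide x₀ s

end Reflections

/-! ### Parabolic subgroups -/

section Parabolic

variable {G : Type*} [Group G]

/-- The subgroup `W_T` generated by `T`. -/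
abbrev parabolic (T : Set G) : Subgroup G := Subgroup.closure T

/-- `T'` is the subset of `T` such that `W_{T'}` is the essential parabolic subgroup of `W_T`:
the least among the parabolic subgroups of `(W_T, T)` that have finite index in `W_T`. -/
def IsEssentialSubset (T T' : Set G) : Prop :=
  T' ⊆ T ∧
    IsLeast {H : Subgroup G | ∃ U ⊆ T, H = parabolic U ∧ H.relIndex (parabolic T) ≠ 0}
      (parabolic T')

/-- `W` is the internal direct product `A × B` of its subgroups `A` and `B`. -/
def IsInternalDirectProduct (W A B : Subgroup G) : Prop :=
  A ⊔ B = W ∧ Disjoint A B ∧ ∀ a ∈ A, ∀ b ∈ B, a * b = b * a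

end Parabolic

/-! ### The boundary at infinity and limit sets -/

section Boundary

variable (X : Type*) [MetricSpace X]

/-- Geodesic rays. -/
structure GeodesicRay where
  /-- The underlying map. -/
  toFun : ℝ≥0 → X
  isometry : Isometry toFun

/-- Two rays are asymptotic if they stay at bounded distance from each other. -/
def asymptoticSetoid : Setoid (GeodesicRay X) where
  r c c' := ∃ K : ℝ, ∀ t : ℝ≥0, dist (c.toFun t) (c'.toFun t) ≤ K
  iseqv :=
    { refl := fun _ => ⟨0, fun _ => by simp⟩
      symm := fun ⟨K, hK⟩ => ⟨K, fun t => by rw [dist_comm]; exact hK t⟩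
      trans := fun ⟨K, hK⟩ ⟨K', hK'⟩ =>
        ⟨K + K', fun t => (dist_triangle _ _ _).trans (add_le_add (hK t) (hK' t))⟩ }

/-- The boundary at infinity `∂X`: asymptoty classes of geodesic rays. -/
def Boundary : Type _ := Quotient (asymptoticSetoid X)

variable {X}

/-- The endpoint `c(∞)` of a ray. -/
def GeodesicRay.endpoint (c : GeodesicRay X) : Boundary X := Quotient.mk (asymptoticSetoid X) c

/-- The image of a ray under an isometry. -/
def GeodesicRay.map (γ : X ≃ᵢ X) (c : GeodesicRay X) : GeodesicRay X :=
  ⟨γ ∘ c.toFun, γ.isometry.comp c.isometry⟩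

/-- The action of an isometry on the boundary: `γ · c(∞) = (γ ∘ c)(∞)`. -/
def boundaryMap (γ : X ≃ᵢ X) : Boundary X → Boundary X :=
  Quotient.map (sa := asymptoticSetoid X) (sb := asymptoticSetoid X) (GeodesicRay.map γ)
    (fun _ _ ⟨K, hK⟩ => ⟨K, fun t => (γ.isometry.dist_eq _ _).trans_le (hK t)⟩)

/-- The basic cone neighbourhood `U(c, r, ε)` in `X ∪ ∂X` (`c` a ray from `x₀`): the points of `X`
at distance greater than `r` from `x₀`, and the points of `∂X`, for which the geodesic
(resp. the ray) from `x₀` to the point passes, at time `r`, at distance less than `ε`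
from `c(r)`. -/
def coneNhd (x₀ : X) (c : GeodesicRay X) (r : ℝ≥0) (ε : ℝ) : Set (X ⊕ Boundary X) :=
  Sum.inl '' {x | r < dist x₀ x ∧ ∃ ξ : ℝ → X, IsGeodesic ξ x₀ x ∧ dist (ξ r) (c.toFun r) < ε} ∪
  Sum.inr '' {α | ∃ c' : GeodesicRay X, c'.toFun 0 = x₀ ∧ c'.endpoint = α ∧
    dist (c'.toFun r) (c.toFun r) < ε}

/-- The cone topology on `X ∪ ∂X`, generated by the open subsets of `X` and the sets `U(c, r, ε)`
for `c` a ray issuing from `x₀`. (For a complete CAT(0) space it is independent of `x₀`.) -/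
@[reducible] def coneTopology (x₀ : X) : TopologicalSpace (X ⊕ Boundary X) :=
  TopologicalSpace.generateFrom
    ({V | ∃ O : Set X, IsOpen O ∧ V = Sum.inl '' O} ∪
     {V | ∃ (c : GeodesicRay X) (r : ℝ≥0) (ε : ℝ),
        c.toFun 0 = x₀ ∧ 0 < r ∧ 0 < ε ∧ V = coneNhd x₀ c r ε})

/-- The limit set `L(Γ)`: the intersection with `∂X` of the closure in `X ∪ ∂X` of the
orbit `Γ x₀`. -/
def limitSet (Γ : Subgroup (X ≃ᵢ X)) (x₀ : X) : Set (Boundary X) :=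
  {α | Sum.inr α ∈
    @closure (X ⊕ Boundary X) (coneTopology x₀) (Sum.inl '' {x | ∃ γ ∈ Γ, γ x₀ = x})}

/-- Invariance of a set of boundary points under a group of isometries. -/
def IsInvariant (W : Subgroup (X ≃ᵢ X)) (L : Set (Boundary X)) : Prop :=
  ∀ w ∈ W, boundaryMap w '' L = L

end Boundary

end CatReflection

/-! Let N(w) be the set of reflections in W whose wall separates `x₀` from `w x₀`. A wall has just
two sides, so N satisfies a cocycle rule, and minimality of S gives N(s) = {s} for s in S. These
facts alone yield the Coxeter combinatorics of parabolic subgroups: the exchange property, W_U ∩ W_V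
= W_{U∩V}, and, for s ∉ T, W_T ∩ sW_Ts ⊆ W_U with U = {t ∈ T | st = ts} (`mem_parabolic_commuting`).
Since S is finite and finite index survives intersections, a minimal U ⊆ T with W_U of finite index
in W_T is the least one; this is T̃.

Finite index does not change the limit set, so L(W_T) = L(W_T̃). If W = W_T̃ × W_{S∖T̃}, then W_T̃
is normal in W and its limit set is invariant.

Conversely, let L(W_T̃) be invariant, let s ∈ S∖T̃, and let H be generated by the elements of T̃
commuting with s. If H had infinite index in W_T̃, some ray c towards L(W_T̃) would leave the orbit
of H at unit speed (`exists_escaping_ray`). By invariance s·c also points to L(W_T̃). Orbits of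
parabolic subgroups are quasiconvex, so c(n) stays near u_n x₀ and s·c(n) near v_n x₀ with u_n, v_n
∈ W_T̃. The elements v_n⁻¹ s u_n displace x₀ by a bounded amount, hence take finitely many values.
When the values at m and n agree, s(u_n u_m⁻¹)s = v_n v_m⁻¹ lies in W_T̃, so u_n u_m⁻¹ ∈ H; for
fixed m this keeps c(n) near Hx₀ for arbitrarily large n, a contradiction. So H has finite index in
W_T̃, hence in W_T, and leastness of T̃ forces s to commute with all of T̃. -/

namespace CatReflection

/-! ### Inversion cocycles and parabolic subgroups -/

section Cocycle

variable {G : Type*} [Group G]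

/-- `N` assigns to each element of `W` the set of reflections it inverts: it satisfies the cocycle
rule `N (g h) = N g ∆ g (N h) g⁻¹`, and an element of `S` inverts only itself. -/
structure IsInversionCocycle (W : Subgroup G) (S : Set G) (N : G → Set G) : Prop where
  subset : S ⊆ W
  mul_self : ∀ s ∈ S, s * s = 1
  cocycle : ∀ g ∈ W, ∀ h ∈ W, ∀ r, r ∈ N (g * h) ↔ Xor (r ∈ N g) (g⁻¹ * r * g ∈ N h)
  simple : ∀ s ∈ S, N s = {s}

theorem list_prod_mem_parabolic {T : Set G} {l : List G} (hl : ∀ x ∈ l, x ∈ T) :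
    l.prod ∈ parabolic T :=
  Subgroup.list_prod_mem _ fun x hx => Subgroup.subset_closure (hl x hx)

namespace IsInversionCocycle

variable {W : Subgroup G} {S : Set G} {N : G → Set G} (h : IsInversionCocycle W S N)
  {T : Set G}

include h

theorem inv_eq {s : G} (hs : s ∈ S) : s⁻¹ = s :=
  inv_eq_of_mul_eq_one_left (h.mul_self s hs)

theorem parabolic_le (hT : T ⊆ S) : parabolic T ≤ W :=
  (Subgroup.closure_le W).2 (hT.trans h.subset)

theorem notMem_one (r : G) : r ∉ N 1 := by
  have := h.cocycle 1 W.one_mem 1 W.one_mem r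
  simpa using this

theorem mem_inv_iff {g : G} (hg : g ∈ W) (r : G) : r ∈ N g⁻¹ ↔ g * r * g⁻¹ ∈ N g := by
  have := h.cocycle g⁻¹ (W.inv_mem hg) g hg r
  simp only [inv_mul_cancel, inv_inv, h.notMem_one, Xor] at this
  tauto

/-- Every reflection inverted by an element of a parabolic subgroup lies in that subgroup. -/
theorem subset_parabolic (hT : T ⊆ S) {w : G} (hw : w ∈ parabolic T) :
    N w ⊆ parabolic T := by
  have hle := h.parabolic_le hT
  induction hw using Subgroup.closure_induction with
  | mem x hx =>
    rw [h.simple x (hT hx)]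
    rintro _ rfl
    exact Subgroup.subset_closure hx
  | one => exact fun r hr => (h.notMem_one r hr).elim
  | mul x y hx hy ihx ihy =>
    intro r hr
    rcases (h.cocycle x (hle hx) y (hle hy) r).1 hr with ⟨h1, -⟩ | ⟨h1, -⟩
    · exact ihx h1
    · have := mul_mem (mul_mem hx (ihy h1)) (inv_mem hx)
      simpa [mul_assoc] using this
  | inv x hx ih =>
    intro r hr
    have := mul_mem (mul_mem (inv_mem hx) (ih ((h.mem_inv_iff (hle hx) r).1 hr))) hx
    simpa [mul_assoc] using this

/-- The strong exchange property. -/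
theorem exchange (hT : T ⊆ S) (l : List G) (hl : ∀ x ∈ l, x ∈ T) (r : G) (hr : r ∈ N l.prod) :
    ∃ l' : List G, (∀ x ∈ l', x ∈ T) ∧ l'.length + 1 = l.length ∧ l'.prod = r * l.prod := by
  induction l generalizing r with
  | nil => exact (h.notMem_one r (by simpa using hr)).elim
  | cons a l ih =>
    have ha : a ∈ S := hT (hl a (by simp))
    have hl' : ∀ x ∈ l, x ∈ T := fun x hx => hl x (by simp [hx])
    rw [List.prod_cons, h.cocycle a (h.subset ha) _ (h.parabolic_le hT (list_prod_mem_parabolic hl')),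
      h.simple a ha] at hr
    -- Either `r` is the first letter, which is deleted, or its conjugate by that letter is inverted
    -- by the tail, where a letter is deleted inductively.
    rcases hr with ⟨h1, -⟩ | ⟨h1, -⟩
    · obtain rfl : r = a := h1
      exact ⟨l, hl', by simp, by rw [List.prod_cons, ← mul_assoc, h.mul_self r ha, one_mul]⟩
    · obtain ⟨l', h2, h3, h4⟩ := ih hl' _ h1
      refine ⟨a :: l', ?_, by simp [h3], ?_⟩
      · intro x hx
        rcases List.mem_cons.1 hx with rfl | hx
        · exact hl _ (by simp)
        · exact h2 x hx
      · rw [List.prod_cons, List.prod_cons, h4]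
        group

/-- Every element of a parabolic subgroup is the product of a word. -/
theorem exists_word (hT : T ⊆ S) {w : G} (hw : w ∈ parabolic T) :
    ∃ l : List G, (∀ x ∈ l, x ∈ T) ∧ l.prod = w := by
  induction hw using Subgroup.closure_induction with
  | mem x hx => exact ⟨[x], by simpa using hx, by simp⟩
  | one => exact ⟨[], by simp, rfl⟩
  | mul x y _ _ ihx ihy =>
    obtain ⟨l, hl, rfl⟩ := ihx
    obtain ⟨m, hm, rfl⟩ := ihy
    exact ⟨l ++ m, fun x hx => (List.mem_append.1 hx).elim (hl x) (hm x), by simp⟩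
  | inv x _ ih =>
    obtain ⟨l, hl, rfl⟩ := ih
    refine ⟨l.reverse, fun x hx => hl x (by simpa using hx), ?_⟩
    rw [List.prod_inv_reverse]
    congr 2
    exact (List.map_congr_left (g := id) fun x hx => h.inv_eq (hT (hl x hx))).symm ▸ (by simp)

/-- Induction along reduced words. -/
theorem parabolic_induction (hT : T ⊆ S) {P : G → Prop} (one : P 1)
    (step : ∀ t ∈ T, ∀ w ∈ parabolic T, t ∈ N (t * w) → P w → P (t * w)) {w : G}
    (hw : w ∈ parabolic T) : P w := by
  obtain ⟨l, hl, rfl⟩ := h.exists_word hT hw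
  clear hw
  induction hn : l.length using Nat.strong_induction_on generalizing l with
  | _ n ih =>
    subst hn
    cases l with
    | nil => simpa using one
    | cons t l =>
      have ht : t ∈ T := hl t (by simp)
      have hl' : ∀ x ∈ l, x ∈ T := fun x hx => hl x (by simp [hx])
      have hm := list_prod_mem_parabolic hl'
      rw [List.prod_cons]
      -- The condition `t ∈ N (t * w)` plays the role of "`t * w` is longer than `w`". When it
      -- fails, exchange rewrites the element as a word shorter than the tail.
      by_cases hN : t ∈ N (t * l.prod)
      · exact step t ht _ hm hN (ih l.length (by simp) l hl' rfl)
      · rw [h.cocycle t (h.subset (hT ht)) _ (h.parabolic_le hT hm), h.simple t (hT ht)] at hN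
        have h1 : t ∈ N l.prod := by
          by_contra h1
          exact hN (Or.inl ⟨rfl, by simpa using h1⟩)
        obtain ⟨l', h2, h3, h4⟩ := h.exchange hT l hl' t h1
        rw [← h4]
        exact ih l'.length (by simp; omega) l' h2 rfl

/-- The first letter of a reduced word for `s` in `T` is inverted by `s`, and `s` inverts only
itself. -/
theorem mem_of_mem_parabolic (hT : T ⊆ S) {s : G} (hs : s ∈ S) (hsT : s ∈ parabolic T) :
    s ∈ T := by
  refine h.parabolic_induction hT (P := fun w => w ∈ S → w ∈ T) ?_ ?_ hsT hs
  · intro h1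
    have := h.simple 1 h1
    exact (h.notMem_one 1 (by simp [this])).elim
  · intro t ht w _ hN _ hS
    rw [h.simple _ hS] at hN
    rwa [← show t = t * w from hN]

/-- The first letter of a reduced word in `U` belongs to `N w`, hence to W_V, hence to `V`; strip it
and repeat. -/
theorem mem_parabolic_inter {U V : Set G} (hU : U ⊆ S) (hV : V ⊆ S) {w : G}
    (hwU : w ∈ parabolic U) (hwV : w ∈ parabolic V) : w ∈ parabolic (U ∩ V) := by
  refine h.parabolic_induction hU (P := fun w => w ∈ parabolic V → w ∈ parabolic (U ∩ V))
    (fun _ => one_mem _) ?_ hwU hwV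
  intro t ht w _ hN ih hw
  have htV := h.subset_parabolic hV hw hN
  exact mul_mem (Subgroup.subset_closure ⟨ht, h.mem_of_mem_parabolic hV (hU ht) htV⟩)
    (ih ((mul_mem_cancel_left htV).1 hw))

theorem parabolic_inter {U V : Set G} (hU : U ⊆ S) (hV : V ⊆ S) :
    parabolic (U ∩ V) = parabolic U ⊓ parabolic V :=
  le_antisymm
    (le_inf (Subgroup.closure_mono Set.inter_subset_left)
      (Subgroup.closure_mono Set.inter_subset_right))
    fun _ hw => h.mem_parabolic_inter hU hV hw.1 hw.2

theorem subset_of_parabolic_le {U V : Set G} (hU : U ⊆ S) (hV : V ⊆ S)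
    (hUV : parabolic U ≤ parabolic V) : U ⊆ V := fun _ hu =>
  h.mem_of_mem_parabolic hV (hU hu) (hUV (Subgroup.subset_closure hu))

/-- An element of `W_T` whose conjugate by a simple reflection `s ∉ T` is again in `W_T` commutes
with `s`. -/
theorem commute_of_conj_mem (hT : T ⊆ S) {s w : G} (hs : s ∈ S) (hsT : s ∉ T)
    (hw : w ∈ parabolic T) (hw' : s * w * s ∈ parabolic T) : s * w = w * s := by
  have hle := h.parabolic_le hT
  have hs' : ∀ {v}, v ∈ parabolic T → s ∉ N v := fun hv hN =>
    hsT (h.mem_of_mem_parabolic hT hs (h.subset_parabolic hT hv hN))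
  have h1 : s ∈ N (s * w) := by
    rw [h.cocycle s (h.subset hs) w (hle hw), h.simple s hs]
    exact Or.inl ⟨rfl, by simpa using hs' hw⟩
  -- Since `s` is inverted by the product but not by `s * w * s`, the cocycle rule makes its
  -- conjugate by `s * w * s` an element of `N s = {s}`, which is the commutation relation.
  have h2 : s * w = (s * w * s) * s := by rw [mul_assoc _ s s, h.mul_self s hs, mul_one]
  rw [h2, h.cocycle _ (hle hw') s (h.subset hs), h.simple s hs] at h1
  rcases h1 with ⟨h1, -⟩ | ⟨h1, -⟩
  · exact (hs' hw' h1).elim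
  · have h3 : (s * w * s)⁻¹ * s * (s * w * s) = s := h1
    rw [mul_assoc, inv_mul_eq_iff_eq_mul, ← h2] at h3
    rw [← h3, ← mul_assoc, ← mul_assoc, h.mul_self s hs, one_mul]

/-- For a simple reflection `s ∉ T`, the intersection of `W_T` with its conjugate by `s` is
the parabolic subgroup generated by the elements of `T` commuting with `s`. -/
theorem mem_parabolic_commuting (hT : T ⊆ S) {s w : G} (hs : s ∈ S) (hsT : s ∉ T)
    (hw : w ∈ parabolic T) (hw' : s * w * s ∈ parabolic T) :
    w ∈ parabolic {t ∈ T | s * t = t * s} := by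
  have hle := h.parabolic_le hT
  have hs' : ∀ {v}, v ∈ parabolic T → s ∉ N v := fun hv hN =>
    hsT (h.mem_of_mem_parabolic hT hs (h.subset_parabolic hT hv hN))
  have hss := h.mul_self s hs
  have hsi := h.inv_eq hs
  refine h.parabolic_induction hT
    (P := fun w => s * w = w * s → w ∈ parabolic {t ∈ T | s * t = t * s})
    (fun _ => one_mem _) ?_ hw (h.commute_of_conj_mem hT hs hsT hw hw')
  intro t ht w hw hN ih hc
  have htT : t ∈ parabolic T := Subgroup.subset_closure ht
  have hm := mul_mem htT hw
  -- The first letter `t` stays inverted after right multiplication by `s`. Moving `s` to the left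
  -- by commutation shows that `s * t * s` is inverted by `t * w`, so it lies in W_T and `t` itself
  -- commutes with `s`.
  have h1 : t ∈ N (t * w * s) := by
    rw [h.cocycle _ (hle hm) s (h.subset hs)]
    refine Or.inl ⟨hN, fun hx => ?_⟩
    rw [h.simple s hs] at hx
    have hx : (t * w)⁻¹ * t * (t * w) = s := hx
    exact hsT (h.mem_of_mem_parabolic hT hs
      (hx ▸ mul_mem (mul_mem (inv_mem hm) htT) hm))
  rw [← hc, h.cocycle s (h.subset hs) _ (hle hm), h.simple s hs, hsi] at h1
  have h2 : s * t * s ∈ parabolic T := by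
    rcases h1 with ⟨h1, -⟩ | ⟨h1, -⟩
    · obtain rfl : t = s := h1
      exact (hsT ht).elim
    · exact h.subset_parabolic hT hm h1
  have hcomm := h.commute_of_conj_mem hT hs hsT htT h2
  refine mul_mem (Subgroup.subset_closure ⟨ht, hcomm⟩) (ih ?_)
  rw [← mul_assoc, hcomm, mul_assoc, mul_assoc, mul_right_inj] at hc
  exact hc

/-- If `S` is finite, every parabolic subgroup has a unique essential parabolic subgroup. -/
theorem existsUnique_isEssentialSubset (hS : S.Finite) (hT : T ⊆ S) :
    ∃! T' : Set G, IsEssentialSubset T T' := by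
  have hne : ∃ U : Set G, U ⊆ T ∧ (parabolic U).relIndex (parabolic T) ≠ 0 :=
    ⟨T, subset_rfl, by simp⟩
  have hfin : {U : Set G | U ⊆ T ∧ (parabolic U).relIndex (parabolic T) ≠ 0}.Finite :=
    (hS.subset hT).finite_subsets.subset fun U hU => hU.1
  -- Finite-index parabolics are closed under intersection, so a minimal one is least.
  obtain ⟨U, hU⟩ := hfin.exists_minimal hne
  have hleast : IsEssentialSubset T U := by
    refine ⟨hU.1.1, ⟨U, hU.1.1, rfl, hU.1.2⟩, ?_⟩
    rintro _ ⟨V, hVT, rfl, hV⟩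
    refine Subgroup.closure_mono fun u hu => (hU.2 (y := U ∩ V) ⟨?_, ?_⟩ Set.inter_subset_left hu).2
    · exact Set.inter_subset_left.trans hU.1.1
    · rw [h.parabolic_inter (hU.1.1.trans hT) (hVT.trans hT)]
      exact Subgroup.relIndex_inf_ne_zero hU.1.2 hV
  refine ⟨U, hleast, fun V hV => ?_⟩
  have heq := hV.2.unique hleast.2
  exact (h.subset_of_parabolic_le (hV.1.trans hT) (hU.1.1.trans hT) heq.le).antisymm
    (h.subset_of_parabolic_le (hU.1.1.trans hT) (hV.1.trans hT) heq.ge)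

end IsInversionCocycle

end Cocycle

/-! ### Geodesics -/

section Geodesic

variable {X : Type*} [MetricSpace X]

namespace IsGeodesic

variable {ξ : ℝ → X} {x y : X}

theorem dist_left (h : IsGeodesic ξ x y) {t : ℝ} (ht : t ∈ Set.Icc 0 (dist x y)) :
    dist x (ξ t) = t := by
  have := h.2.2 0 ⟨le_rfl, dist_nonneg⟩ t ht
  rwa [h.1, zero_sub, abs_neg, abs_of_nonneg ht.1] at this

theorem dist_right (h : IsGeodesic ξ x y) {t : ℝ} (ht : t ∈ Set.Icc 0 (dist x y)) :
    dist (ξ t) y = dist x y - t := by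
  have := h.2.2 t ht _ ⟨dist_nonneg, le_rfl⟩
  rwa [h.2.1, abs_sub_comm, abs_of_nonneg (sub_nonneg.2 ht.2)] at this

theorem isPreconnected_image (h : IsGeodesic ξ x y) :
    IsPreconnected (ξ '' Set.Icc 0 (dist x y)) := by
  refine isPreconnected_Icc.image _ (LipschitzOnWith.continuousOn (K := 1) ?_)
  refine LipschitzOnWith.of_dist_le_mul fun s hs t ht => ?_
  rw [h.2.2 s hs t ht, NNReal.coe_one, one_mul, Real.dist_eq]

theorem left_mem_image (h : IsGeodesic ξ x y) : x ∈ ξ '' Set.Icc 0 (dist x y) :=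
  ⟨0, ⟨le_rfl, dist_nonneg⟩, h.1⟩

theorem right_mem_image (h : IsGeodesic ξ x y) : y ∈ ξ '' Set.Icc 0 (dist x y) :=
  ⟨_, ⟨dist_nonneg, le_rfl⟩, h.2.1⟩

theorem comp_isometryEquiv (h : IsGeodesic ξ x y) (g : X ≃ᵢ X) :
    IsGeodesic (g ∘ ξ) (g x) (g y) := by
  refine ⟨by simp [h.1], by rw [g.dist_eq, Function.comp, h.2.1], fun s hs t ht => ?_⟩
  rw [g.dist_eq] at hs ht
  rw [Function.comp, Function.comp, g.dist_eq, h.2.2 s hs t ht]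

theorem reverse (h : IsGeodesic ξ x y) : IsGeodesic (fun t => ξ (dist x y - t)) y x := by
  refine ⟨by simp [h.2.1], by simp [dist_comm y x, h.1], fun s hs t ht => ?_⟩
  rw [dist_comm y x] at hs ht
  rw [h.2.2 _ ⟨by linarith [hs.2], by linarith [hs.1]⟩ _ ⟨by linarith [ht.2], by linarith [ht.1]⟩,
    abs_sub_comm]
  congr 1
  ring

end IsGeodesic

/-- A point realizing equality in the triangle inequality lies on a geodesic. -/
theorem IsGeodesicSpace.exists_through (hX : IsGeodesicSpace X) {x y z : X}
    (h : dist x z + dist z y = dist x y) :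
    ∃ ξ : ℝ → X, IsGeodesic ξ x y ∧ ∃ t ∈ Set.Icc 0 (dist x y), ξ t = z := by
  obtain ⟨ξ, hξ⟩ := hX x z
  obtain ⟨η, hη⟩ := hX z y
  have hxz := dist_nonneg (x := x) (y := z)
  have hzy := dist_nonneg (x := z) (y := y)
  let ζ : ℝ → X := fun t => if t ≤ dist x z then ξ t else η (t - dist x z)
  have h1 : ∀ t, t ≤ dist x z → ζ t = ξ t := fun t ht => if_pos ht
  have h2 : ∀ t, dist x z ≤ t → ζ t = η (t - dist x z) := by
    intro t ht
    rcases ht.eq_or_lt with rfl | ht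
    · rw [h1 _ le_rfl, hξ.2.1, sub_self, hη.1]
    · exact if_neg ht.not_ge
  have key : ∀ s ∈ Set.Icc 0 (dist x y), ∀ t ∈ Set.Icc 0 (dist x y), s ≤ t →
      dist (ζ s) (ζ t) = t - s := by
    intro s hs t ht hst
    rcases le_total t (dist x z) with ht' | ht'
    · rw [h1 _ ht', h1 _ (hst.trans ht'), hξ.2.2 s ⟨hs.1, hst.trans ht'⟩ t ⟨ht.1, ht'⟩,
        abs_sub_comm, abs_of_nonneg (sub_nonneg.2 hst)]
    · rcases le_total s (dist x z) with hs' | hs'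
      · have ht2 : t - dist x z ∈ Set.Icc 0 (dist z y) :=
          ⟨sub_nonneg.2 ht', by linarith [ht.2]⟩
        rw [h2 _ ht', h1 _ hs']
        have a1 := hξ.dist_left ⟨hs.1, hs'⟩
        have a2 := hξ.dist_right ⟨hs.1, hs'⟩
        have a3 := hη.dist_left ht2
        have a4 := hη.dist_right ht2
        have a5 := dist_triangle (ξ s) z (η (t - dist x z))
        have a6 := dist_triangle4 x (ξ s) (η (t - dist x z)) y
        -- A distance shorter than `t - s` across the junction would give a path from `x` to `y`
        -- shorter than `dist x y`.
        linarith
      · rw [h2 _ ht', h2 _ hs', hη.2.2 _ ⟨sub_nonneg.2 hs', by linarith [hs.2]⟩ _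
          ⟨sub_nonneg.2 ht', by linarith [ht.2]⟩, abs_sub_comm, abs_of_nonneg (by linarith)]
        ring
  refine ⟨ζ, ⟨?_, ?_, ?_⟩, dist x z, ⟨hxz, by linarith⟩, ?_⟩
  · rw [h1 _ hxz, hξ.1]
  · rw [h2 _ (by linarith), ← h, add_sub_cancel_left, hη.2.1]
  · intro s hs t ht
    rcases le_total s t with hst | hst
    · rw [key s hs t ht hst, abs_sub_comm, abs_of_nonneg (sub_nonneg.2 hst)]
    · rw [dist_comm, key t ht s hs hst, abs_of_nonneg (sub_nonneg.2 hst)]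
  · rw [h1 _ le_rfl, hξ.2.1]

theorem IsGeodesicSpace.isPreconnected_ball (hX : IsGeodesicSpace X) (x : X) (ε : ℝ) :
    IsPreconnected (Metric.ball x ε) := by
  refine isPreconnected_of_forall x fun y hy => ?_
  obtain ⟨ξ, hξ⟩ := hX x y
  refine ⟨_, ?_, hξ.left_mem_image, hξ.right_mem_image, hξ.isPreconnected_image⟩
  rintro _ ⟨t, ht, rfl⟩
  rw [Metric.mem_ball'] at hy ⊢
  rw [hξ.dist_left ht]
  exact ht.2.trans_lt hy

theorem IsGeodesicSpace.locallyConnectedSpace (hX : IsGeodesicSpace X) :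
    LocallyConnectedSpace X :=
  locallyConnectedSpace_of_connected_bases Metric.ball (fun _ ε => 0 < ε)
    (fun _ => Metric.nhds_basis_ball) fun x ε _ => hX.isPreconnected_ball x ε

theorem IsGeodesicallyConvex.image {A : Set X} (hA : IsGeodesicallyConvex A) (g : X ≃ᵢ X) :
    IsGeodesicallyConvex (g '' A) := by
  rintro _ ⟨x, hx, rfl⟩ _ ⟨y, hy, rfl⟩ ξ hξ t ht
  have := hξ.comp_isometryEquiv g.symm
  simp only [IsometryEquiv.symm_apply_apply] at this
  rw [g.dist_eq] at ht
  exact ⟨_, hA x hx y hy _ this t ht, by simp⟩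

end Geodesic

/-! ### Sides of walls -/

section Sides

variable {X : Type*} [MetricSpace X] {r : X ≃ᵢ X} {x y z : X}

theorem isClosed_wall (r : X ≃ᵢ X) : IsClosed (wall r) :=
  isClosed_eq r.continuous continuous_id

theorem mem_wall_conj (g r : X ≃ᵢ X) (x : X) : g x ∈ wall (g * r * g⁻¹) ↔ x ∈ wall r := by
  simp [wall]

theorem wall_conj (g r : X ≃ᵢ X) : wall (g * r * g⁻¹) = g '' wall r := by
  ext x
  obtain ⟨x, rfl⟩ := g.surjective x
  rw [mem_wall_conj, g.injective.mem_set_image]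

theorem compl_wall_conj (g r : X ≃ᵢ X) : (wall (g * r * g⁻¹))ᶜ = g '' (wall r)ᶜ := by
  rw [wall_conj, Set.image_compl_eq g.bijective]

theorem image_connectedComponentIn (g : X ≃ᵢ X) {F : Set X} (hx : x ∈ F) :
    g '' connectedComponentIn F x = connectedComponentIn (g '' F) (g x) :=
  g.toHomeomorph.image_connectedComponentIn hx

theorem image_components (g : X ≃ᵢ X) (F : Set X) :
    components (g '' F) = (g '' ·) '' components F := by
  ext K
  constructor
  · rintro ⟨_, ⟨x, hx, rfl⟩, rfl⟩
    exact ⟨_, ⟨x, hx, rfl⟩, image_connectedComponentIn g hx⟩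
  · rintro ⟨_, ⟨x, hx, rfl⟩, rfl⟩
    exact ⟨g x, ⟨x, hx, rfl⟩, image_connectedComponentIn g hx⟩

theorem IsReflection.conj (hr : IsReflection r) (g : X ≃ᵢ X) : IsReflection (g * r * g⁻¹) := by
  obtain ⟨h1, h2, A, B, hAB, hc, hA, hB, hrA, hrB⟩ := hr
  refine ⟨?_, ?_, g '' A, g '' B, ?_, ?_, hA.image g, hB.image g, ?_, ?_⟩
  · rw [show g * r * g⁻¹ * (g * r * g⁻¹) = g * (r * r) * g⁻¹ by group, h1]
    group
  · rw [wall_conj]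
    have := g.toHomeomorph.image_interior (wall r)
    rw [h2, Set.image_empty] at this
    exact this.symm
  · exact fun h => hAB (g.injective.image_injective h)
  · rw [compl_wall_conj, image_components, hc, Set.image_pair]
  · rw [← hrA, Set.image_image, Set.image_image]
    simp
  · rw [← hrB, Set.image_image, Set.image_image]
    simp

theorem self_mem_positiveSide (hx : x ∉ wall r) : x ∈ positiveSide x r :=
  mem_connectedComponentIn hx

theorem notMem_wall_of_mem (hy : y ∈ positiveSide x r) : y ∉ wall r :=
  connectedComponentIn_subset _ _ hy

theorem positiveSide_eq (hy : y ∈ positiveSide x r) : positiveSide x r = positiveSide y r :=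
  connectedComponentIn_eq hy

theorem mem_positiveSide_symm (hx : x ∉ wall r) (hy : y ∈ positiveSide x r) :
    x ∈ positiveSide y r :=
  positiveSide_eq hy ▸ self_mem_positiveSide hx

theorem mem_positiveSide_trans (hy : y ∈ positiveSide x r) (hz : z ∈ positiveSide y r) :
    z ∈ positiveSide x r := by rwa [positiveSide_eq hy]

theorem IsGeodesicSpace.isOpen_positiveSide (hX : IsGeodesicSpace X) (x : X) (r : X ≃ᵢ X) :
    IsOpen (positiveSide x r) :=
  have := hX.locallyConnectedSpace
  (isClosed_wall r).isOpen_compl.connectedComponentIn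

theorem apply_mem_positiveSide_conj (g r : X ≃ᵢ X) (hx : x ∉ wall r) :
    g y ∈ positiveSide (g x) (g * r * g⁻¹) ↔ y ∈ positiveSide x r := by
  rw [positiveSide, compl_wall_conj, ← image_connectedComponentIn g hx,
    g.injective.mem_set_image, positiveSide]

theorem apply_notMem_wall (hx : x ∉ wall r) : r x ∉ wall r := fun h => hx (by
  have h : r (r x) = r x := h
  exact r.injective h)

namespace IsReflection

variable (hr : IsReflection r)

include hr

theorem convex_positiveSide (hx : x ∉ wall r) : IsGeodesicallyConvex (positiveSide x r) := by
  obtain ⟨-, -, A, B, -, hc, hA, hB, -, -⟩ := hr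
  have : positiveSide x r ∈ components (wall r)ᶜ := ⟨x, hx, rfl⟩
  rw [hc] at this
  rcases this with h | h <;> rw [h] <;> assumption

theorem mem_positiveSide_of_notMem (hx : x ∉ wall r) (hy : y ∉ wall r) (hz : z ∉ wall r)
    (hxy : y ∉ positiveSide x r) (hxz : z ∉ positiveSide x r) : z ∈ positiveSide y r := by
  obtain ⟨-, -, A, B, -, hc, -, -, -, -⟩ := hr
  have key : ∀ w, w ∉ wall r → positiveSide w r = A ∨ positiveSide w r = B := by
    intro w hw
    have : positiveSide w r ∈ components (wall r)ᶜ := ⟨w, hw, rfl⟩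
    rwa [hc] at this
  have hy' := self_mem_positiveSide hy
  have hz' := self_mem_positiveSide hz
  rcases key x hx with h1 | h1 <;> rcases key y hy with h2 | h2 <;>
    rcases key z hz with h3 | h3 <;> simp_all

theorem apply_notMem_positiveSide (hx : x ∉ wall r) : r x ∉ positiveSide x r := by
  obtain ⟨-, -, A, B, hAB, hc, -, -, hrA, hrB⟩ := hr
  have h1 : positiveSide x r ∈ components (wall r)ᶜ := ⟨x, hx, rfl⟩
  have hA : A ∈ components (wall r)ᶜ := by simp [hc]
  have hB : B ∈ components (wall r)ᶜ := by simp [hc]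
  have hx' := self_mem_positiveSide hx
  have hdisj : ∀ w, w ∈ A → w ∉ B := by
    obtain ⟨a, -, rfl⟩ := hA
    obtain ⟨b, -, rfl⟩ := hB
    intro w hwA hwB
    exact hAB ((connectedComponentIn_eq hwA).trans (connectedComponentIn_eq hwB).symm)
  rw [hc] at h1
  intro h2
  rcases h1 with h1 | h1 <;> rw [h1] at hx' h2
  · exact hdisj _ h2 (hrA ▸ Set.mem_image_of_mem r hx')
  · exact hdisj _ (hrB ▸ Set.mem_image_of_mem r hx') h2

/-- If the wall of `r` separates `x` from `y`, then reflecting `y` brings it closer to `x`. -/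
theorem dist_apply_lt (hX : IsGeodesicSpace X) (hx : x ∉ wall r) (hy : y ∉ wall r)
    (hxy : y ∉ positiveSide x r) : dist x (r y) < dist x y := by
  obtain ⟨ξ, hξ⟩ := hX x y
  obtain ⟨t, ht, hz⟩ : ∃ t ∈ Set.Icc 0 (dist x y), ξ t ∈ wall r := by
    by_contra! hcon
    refine hxy (hξ.isPreconnected_image.subset_connectedComponentIn hξ.left_mem_image ?_
      hξ.right_mem_image)
    rintro _ ⟨t, ht, rfl⟩
    exact hcon t ht
  -- Reflecting the part of the geodesic beyond the wall gives a path to `r y` of the same length.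
  -- Were it shortest, the wall point would lie on a geodesic between two points of one side,
  -- against convexity.
  have h1 : dist (ξ t) (r y) = dist (ξ t) y := by
    conv_lhs => rw [← show r (ξ t) = ξ t from hz]
    exact r.dist_eq _ _
  have h2 := hξ.dist_left ht
  have h3 := hξ.dist_right ht
  have h4 := dist_triangle x (ξ t) (r y)
  refine lt_of_le_of_ne (by linarith) fun heq => ?_
  obtain ⟨η, hη, u, hu, hηu⟩ := hX.exists_through (x := x) (y := r y) (z := ξ t) (by linarith)
  have h5 : r y ∈ positiveSide x r := by
    refine hr.mem_positiveSide_of_notMem hy hx (apply_notMem_wall hy)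
      (fun h => hxy (mem_positiveSide_symm hy h)) (hr.apply_notMem_positiveSide hy)
  have h6 := hr.convex_positiveSide hx x (self_mem_positiveSide hx) _ h5 η hη u hu
  exact notMem_wall_of_mem h6 (hηu ▸ hz)

end IsReflection

end Sides

/-! ### Chambers of reflection groups -/

section Chambers

variable {X : Type*} [MetricSpace X] {W : Subgroup (X ≃ᵢ X)}

theorem mem_wallComplement {x : X} : x ∈ wallComplement W ↔ ∀ r ∈ reflections W, x ∉ wall r := by
  simp [wallComplement]

theorem conj_mem_reflections {g r : X ≃ᵢ X} (hg : g ∈ W) (hr : r ∈ reflections W) :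
    g * r * g⁻¹ ∈ reflections W :=
  ⟨mul_mem (mul_mem hg hr.1) (inv_mem hg), hr.2.conj g⟩

theorem apply_mem_wallComplement {g : X ≃ᵢ X} (hg : g ∈ W) {x : X} (hx : x ∈ wallComplement W) :
    g x ∈ wallComplement W := by
  rw [mem_wallComplement] at hx ⊢
  intro r hr h
  have h1 := conj_mem_reflections (inv_mem hg) hr
  refine hx _ h1 ?_
  rw [← mem_wall_conj g]
  convert h using 2
  group

theorem image_wallComplement {g : X ≃ᵢ X} (hg : g ∈ W) :
    g '' wallComplement W = wallComplement W := by
  refine Set.Subset.antisymm ?_ fun x hx => ?_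
  · rintro _ ⟨x, hx, rfl⟩
    exact apply_mem_wallComplement hg hx
  · exact ⟨g⁻¹ x, apply_mem_wallComplement (inv_mem hg) hx, by simp⟩

namespace IsProperAction

variable (hP : IsProperAction W)

include hP

theorem finite_dist_le (x y : X) (N : ℝ) : {γ | γ ∈ W ∧ dist (γ x) y ≤ N}.Finite := by
  refine (hP x (|N| + dist x y + 1) (by positivity)).subset fun γ hγ => ⟨hγ.1, ?_⟩
  rw [Metric.mem_ball]
  have := dist_triangle (γ x) y x
  have := hγ.2
  have := le_abs_self N
  rw [dist_comm x y]
  linarith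

theorem exists_min_dist {Γ : Subgroup (X ≃ᵢ X)} (hΓ : Γ ≤ W) (x y : X) :
    ∃ u ∈ Γ, ∀ v ∈ Γ, dist x (u y) ≤ dist x (v y) := by
  have hfin : {γ | γ ∈ Γ ∧ dist (γ y) x ≤ dist y x}.Finite :=
    (hP.finite_dist_le y x (dist y x)).subset fun γ hγ => ⟨hΓ hγ.1, hγ.2⟩
  obtain ⟨u, hu, hmin⟩ := Set.exists_min_image _ (fun γ => dist x (γ y)) hfin
    ⟨1, one_mem _, le_rfl⟩
  refine ⟨u, hu.1, fun v hv => ?_⟩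
  by_cases h : dist (v y) x ≤ dist y x
  · exact hmin v ⟨hv, h⟩
  · rw [dist_comm x, dist_comm x]
    exact hu.2.trans (not_le.1 h).le

/-- A reflection fixing a point of the ball displaces its centre by at most `2 * ε`, so properness
applies. -/
theorem finite_walls (x : X) (ε : ℝ) :
    {r | r ∈ reflections W ∧ ∃ y ∈ Metric.ball x ε, y ∈ wall r}.Finite := by
  refine (hP.finite_dist_le x x (2 * ε)).subset ?_
  rintro r ⟨hr, y, hy, hry⟩
  refine ⟨hr.1, ?_⟩
  have h1 : dist (r x) y = dist x y := by
    conv_lhs => rw [← show r y = y from hry]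
    exact r.dist_eq _ _
  have := dist_triangle (r x) y x
  rw [Metric.mem_ball] at hy
  rw [dist_comm x y] at h1
  linarith

/-- The family of walls is locally finite. -/
theorem exists_ball_disjoint_walls (z : X) :
    ∃ ε > 0, ∀ r ∈ reflections W, z ∉ wall r → ∀ y ∈ Metric.ball z ε, y ∉ wall r := by
  let P := {r | r ∈ reflections W ∧ ∃ y ∈ Metric.ball z 1, y ∈ wall r} ∩ {r | z ∉ wall r}
  have hP : P.Finite := (hP.finite_walls z 1).inter_of_left _
  have hU : IsOpen (⋂ r ∈ P, (wall r)ᶜ) :=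
    hP.isOpen_biInter fun r _ => (isClosed_wall r).isOpen_compl
  obtain ⟨ε, hε, h⟩ := Metric.isOpen_iff.1 hU z (by simp only [Set.mem_iInter]; exact fun r hr => hr.2)
  refine ⟨min ε 1, by positivity, fun r hr hz y hy hyr => ?_⟩
  have h1 := h (Metric.ball_subset_ball (min_le_left _ _) hy)
  simp only [Set.mem_iInter] at h1
  exact h1 r ⟨⟨hr, y, Metric.ball_subset_ball (min_le_right _ _) hy, hyr⟩, hz⟩ hyr

theorem exists_ball_subset_positiveSide (hX : IsGeodesicSpace X) (z : X) :
    ∃ ε > 0, ∀ r ∈ reflections W, z ∉ wall r → ∀ y ∈ Metric.ball z ε, y ∈ positiveSide z r := by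
  obtain ⟨ε, hε, h⟩ := hP.exists_ball_disjoint_walls z
  exact ⟨ε, hε, fun r hr hz y hy => (hX.isPreconnected_ball z ε).subset_connectedComponentIn
    (Metric.mem_ball_self hε) (h r hr hz) hy⟩

/-- Only finitely many walls meet a ball, and a finite intersection of dense open sets is dense. -/
theorem dense_wallComplement : Dense (wallComplement W) := by
  have key : ∀ P : Set (X ≃ᵢ X), P.Finite → P ⊆ reflections W →
      Dense (⋂ r ∈ P, (wall r)ᶜ) ∧ IsOpen (⋂ r ∈ P, (wall r)ᶜ) := by
    intro P hP
    induction P, hP using Set.Finite.induction_on with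
    | empty => simp
    | @insert r P _ _ ih =>
      intro hPR
      obtain ⟨h1, h2⟩ := ih fun s hs => hPR (Set.mem_insert_of_mem _ hs)
      have ho := (isClosed_wall r).isOpen_compl
      rw [Set.biInter_insert]
      refine ⟨Dense.inter_of_isOpen_left ?_ h1 ho, ho.inter h2⟩
      rw [← interior_eq_empty_iff_dense_compl]
      exact (hPR (Set.mem_insert _ _)).2.2.1
  rw [Metric.dense_iff]
  intro x ε hε
  obtain ⟨h1, -⟩ := key _ (hP.finite_walls x ε) fun r hr => hr.1
  obtain ⟨y, hy, hy'⟩ := Metric.dense_iff.1 h1 x ε hε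
  refine ⟨y, hy, mem_wallComplement.2 fun r hr hyr => ?_⟩
  simp only [Set.mem_iInter] at hy'
  exact hy' r ⟨hr, y, hy, hyr⟩ hyr

/-- A subgroup `Γ` of `W` moves each point off the walls to the same side as `x` of every wall of
`Γ`. -/
theorem exists_apply_mem_positiveSide (hX : IsGeodesicSpace X) {Γ : Subgroup (X ≃ᵢ X)}
    (hΓ : Γ ≤ W) {x y : X} (hx : x ∈ wallComplement W) (hy : y ∈ wallComplement W) :
    ∃ u ∈ Γ, ∀ r ∈ reflections W, r ∈ Γ → u y ∈ positiveSide x r := by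
  obtain ⟨u, hu, hmin⟩ := hP.exists_min_dist hΓ x y
  refine ⟨u, hu, fun r hr hrΓ => ?_⟩
  by_contra hcon
  -- If a wall of `Γ` separated `x` from the orbit point nearest to it, reflecting in that wall
  -- would bring the point nearer.
  refine absurd (hmin (r * u) (mul_mem hrΓ hu)) (not_le.2 ?_)
  exact hr.2.dist_apply_lt hX (mem_wallComplement.1 hx r hr)
    (mem_wallComplement.1 (apply_mem_wallComplement (hΓ hu) hy) r hr) hcon

end IsProperAction

/-- Sides are convex, so a geodesic between points on the same side of every wall meets no wall. -/
theorem mem_chamber_iff (hX : IsGeodesicSpace X) {x y : X} (hx : x ∈ wallComplement W) :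
    y ∈ chamber W x ↔ y ∈ wallComplement W ∧ ∀ r ∈ reflections W, y ∈ positiveSide x r := by
  constructor
  · intro hy
    refine ⟨connectedComponentIn_subset _ _ hy, fun r hr => ?_⟩
    exact connectedComponentIn_mono x (fun z hz => mem_wallComplement.1 hz r hr) hy
  · rintro ⟨hy, h⟩
    obtain ⟨ξ, hξ⟩ := hX x y
    refine hξ.isPreconnected_image.subset_connectedComponentIn hξ.left_mem_image ?_
      hξ.right_mem_image
    rintro _ ⟨t, ht, rfl⟩
    refine mem_wallComplement.2 fun r hr => ?_
    have hxr := mem_wallComplement.1 hx r hr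
    exact notMem_wall_of_mem (hr.2.convex_positiveSide hxr x (self_mem_positiveSide hxr) y
      (h r hr) ξ hξ t ht)

/-- The reflections of `W` whose wall separates `x` from `w x`. -/
def inversions (W : Subgroup (X ≃ᵢ X)) (x : X) (w : X ≃ᵢ X) : Set (X ≃ᵢ X) :=
  {r | r ∈ reflections W ∧ w x ∉ positiveSide x r}

/-- With only two sides, a wall separates `x` from `g h x` exactly when it separates one, but not
both, of the pairs `x, g x` and `g x, g h x`; the second pair is the `g`-translate of `x, h x`. -/
theorem mem_inversions_mul {x : X} (hx : x ∈ wallComplement W) {g h : X ≃ᵢ X} (hg : g ∈ W)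
    (hh : h ∈ W) (r : X ≃ᵢ X) :
    r ∈ inversions W x (g * h) ↔
      Xor (r ∈ inversions W x g) (g⁻¹ * r * g ∈ inversions W x h) := by
  have hconj : g * (g⁻¹ * r * g) * g⁻¹ = r := by group
  have hR : g⁻¹ * r * g ∈ reflections W ↔ r ∈ reflections W := by
    constructor
    · intro h1
      have := conj_mem_reflections hg h1
      rwa [hconj] at this
    · intro h1
      have := conj_mem_reflections (inv_mem hg) h1
      rwa [inv_inv] at this
  by_cases hr : r ∈ reflections W
  · have ha := mem_wallComplement.1 hx r hr
    have hb := mem_wallComplement.1 (apply_mem_wallComplement hg hx) r hr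
    have hc := mem_wallComplement.1 (apply_mem_wallComplement (mul_mem hg hh) hx) r hr
    have h1 : h x ∈ positiveSide x (g⁻¹ * r * g) ↔ (g * h) x ∈ positiveSide (g x) r := by
      rw [← apply_mem_positiveSide_conj g _ (mem_wallComplement.1 hx _ (hR.2 hr)), hconj]
      rfl
    have h2 : r ∈ inversions W x (g * h) ↔ (g * h) x ∉ positiveSide x r := and_iff_right hr
    have h3 : r ∈ inversions W x g ↔ g x ∉ positiveSide x r := and_iff_right hr
    have h4 : g⁻¹ * r * g ∈ inversions W x h ↔ (g * h) x ∉ positiveSide (g x) r :=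
      (and_iff_right (hR.2 hr)).trans (not_congr h1)
    rw [h2, h3, h4]
    by_cases hgx : g x ∈ positiveSide x r
    · simp [positiveSide_eq hgx, self_mem_positiveSide hb, Xor]
    · by_cases hghx : (g * h) x ∈ positiveSide x r
      · have : (g * h) x ∉ positiveSide (g x) r := fun h5 =>
          hgx (mem_positiveSide_trans hghx (mem_positiveSide_symm hb h5))
        simp only [hgx, hghx, this, Xor]
        tauto
      · have := hr.2.mem_positiveSide_of_notMem ha hb hc hgx hghx
        simp only [hgx, hghx, this, Xor]
        tauto
  · simp [inversions, hr, hR, Xor]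

end Chambers

/-! ### The Coxeter structure of a cocompact discrete reflection group -/

section Coxeter

variable {X : Type*} [MetricSpace X] {W : Subgroup (X ≃ᵢ X)} {x₀ : X} {S : Set (X ≃ᵢ X)}

theorem self_mem_chamber (hx₀ : x₀ ∈ wallComplement W) : x₀ ∈ chamber W x₀ :=
  mem_connectedComponentIn hx₀

theorem chamber_mem_components (hx₀ : x₀ ∈ wallComplement W) :
    chamber W x₀ ∈ components (wallComplement W) := ⟨x₀, hx₀, rfl⟩

namespace IsCocompactDiscreteReflectionGroup

variable (hW : IsCocompactDiscreteReflectionGroup W)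

include hW

theorem eq_one_of_apply_mem_chamber (hx₀ : x₀ ∈ wallComplement W) {γ : X ≃ᵢ X} (hγ : γ ∈ W)
    {x : X} (hx : x ∈ chamber W x₀) (h : γ x ∈ chamber W x₀) : γ = 1 := by
  refine (hW.2.2 _ (chamber_mem_components hx₀)).2 γ hγ ?_
  have h1 : chamber W x₀ = chamber W x := connectedComponentIn_eq hx
  have h2 : chamber W x₀ = chamber W (γ x) := connectedComponentIn_eq h
  have hx' : x ∈ wallComplement W := connectedComponentIn_subset _ _ hx
  conv_lhs => rw [h1, chamber, image_connectedComponentIn γ hx', image_wallComplement hγ]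
  exact h2.symm

/-- Chambers have finite diameter. -/
theorem exists_dist_le_of_mem_chamber (hx₀ : x₀ ∈ wallComplement W) :
    ∃ D : ℝ, 0 ≤ D ∧ ∀ y ∈ closure (chamber W x₀), dist x₀ y ≤ D := by
  obtain ⟨D, hD⟩ := (hW.2.2 _ (chamber_mem_components hx₀)).1.isBounded.subset_closedBall x₀
  have h : ∀ y ∈ closure (chamber W x₀), dist x₀ y ≤ D := fun y hy =>
    Metric.mem_closedBall'.1 (hD hy)
  exact ⟨D, by simpa using h x₀ (subset_closure (self_mem_chamber hx₀)), h⟩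

theorem exists_apply_mem_chamber (hX : IsGeodesicSpace X) (hx₀ : x₀ ∈ wallComplement W) {y : X}
    (hy : y ∈ wallComplement W) : ∃ w ∈ W, w y ∈ chamber W x₀ := by
  obtain ⟨w, hw, h⟩ := hW.2.1.exists_apply_mem_positiveSide hX le_rfl hx₀ hy
  exact ⟨w, hw, (mem_chamber_iff hX hx₀).2
    ⟨apply_mem_wallComplement hw hy, fun r hr => h r hr hr.1⟩⟩

/-- Finitely many translates of the compact closed chamber cover a given ball: they cover its points
off the walls, which are dense, and their union is closed. -/
theorem properSpace (hX : IsGeodesicSpace X) (hx₀ : x₀ ∈ wallComplement W) : ProperSpace X := by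
  obtain ⟨D, -, hD⟩ := hW.exists_dist_le_of_mem_chamber hx₀
  refine ⟨fun x R => ?_⟩
  have hF := hW.2.1.finite_dist_le x₀ x (R + 1 + D)
  have hK : IsCompact (⋃ w ∈ {γ | γ ∈ W ∧ dist (γ x₀) x ≤ R + 1 + D},
      w '' closure (chamber W x₀)) :=
    hF.isCompact_biUnion fun w _ =>
      (hW.2.2 _ (chamber_mem_components hx₀)).1.image w.continuous
  refine hK.of_isClosed_subset Metric.isClosed_closedBall fun y hy => ?_
  refine hK.isClosed.closure_subset ?_
  rw [Metric.mem_closure_iff]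
  intro ε hε
  obtain ⟨z, hz, hz'⟩ := Metric.dense_iff.1 hW.2.1.dense_wallComplement y (min ε 1)
    (by positivity)
  obtain ⟨w, hw, hwz⟩ := hW.exists_apply_mem_chamber hX hx₀ hz'
  rw [Metric.mem_ball'] at hz
  refine ⟨z, ?_, hz.trans_le (min_le_left _ _)⟩
  simp only [Set.mem_iUnion]
  refine ⟨w⁻¹, ⟨inv_mem hw, ?_⟩, w z, subset_closure hwz, by simp⟩
  have h1 := hD _ (subset_closure hwz)
  have h2 : dist (w⁻¹ x₀) z = dist x₀ (w z) := by
    rw [← w.dist_eq]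
    simp
  have h3 := dist_triangle4 (w⁻¹ x₀) z y x
  have h4 := hz.le.trans (min_le_right _ _)
  rw [Metric.mem_closedBall] at hy
  rw [dist_comm] at h4
  linarith

/-- Orbits of subgroups containing all reflections that separate their orbit points are
quasiconvex. -/
theorem exists_quasiconvex (hX : IsGeodesicSpace X) (hx₀ : x₀ ∈ wallComplement W) :
    ∃ D : ℝ, 0 ≤ D ∧ ∀ Γ ≤ W, (∀ w ∈ Γ, inversions W x₀ w ⊆ Γ) → ∀ w ∈ Γ, ∀ ξ : ℝ → X,
      IsGeodesic ξ x₀ (w x₀) → ∀ t ∈ Set.Icc 0 (dist x₀ (w x₀)),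
      ∃ u ∈ Γ, dist (ξ t) (u x₀) ≤ D := by
  obtain ⟨D, hD0, hD⟩ := hW.exists_dist_le_of_mem_chamber hx₀
  refine ⟨D + 1, by positivity, fun Γ hΓ hinv w hw ξ hξ t ht => ?_⟩
  have hside : ∀ v ∈ Γ, ∀ r ∈ reflections W, r ∉ Γ → v x₀ ∈ positiveSide x₀ r := by
    intro v hv r hr hrΓ
    by_contra hcon
    exact hrΓ (hinv v hv ⟨hr, hcon⟩)
  obtain ⟨ε, hε, hball⟩ := hW.2.1.exists_ball_subset_positiveSide hX (ξ t)
  obtain ⟨y, hy, hy'⟩ := Metric.dense_iff.1 hW.2.1.dense_wallComplement (ξ t) (min ε 1)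
    (by positivity)
  have hyr : ∀ r ∈ reflections W, r ∉ Γ → y ∈ positiveSide x₀ r := by
    intro r hr hrΓ
    have h0 := mem_wallComplement.1 hx₀ r hr
    have h1 := hr.2.convex_positiveSide h0 _ (self_mem_positiveSide h0) _ (hside w hw r hr hrΓ)
      ξ hξ t ht
    exact mem_positiveSide_trans h1 (hball r hr (notMem_wall_of_mem h1) y
      (Metric.ball_subset_ball (min_le_left _ _) hy))
  -- By convexity `y` is on the side of `x₀` for every wall outside `Γ`. The element `u ∈ Γ`
  -- corrects the walls of `Γ`, while conjugation by `u` permutes the others, so `u y` lands in the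
  -- chamber.
  obtain ⟨u, hu, hur⟩ := hW.2.1.exists_apply_mem_positiveSide hX hΓ hx₀ hy'
  have huC : u y ∈ chamber W x₀ := by
    refine (mem_chamber_iff hX hx₀).2 ⟨apply_mem_wallComplement (hΓ hu) hy', fun r hr => ?_⟩
    by_cases hrΓ : r ∈ Γ
    · exact hur r hr hrΓ
    · have h1 : u⁻¹ * r * u ∈ reflections W := by
        have := conj_mem_reflections (inv_mem (hΓ hu)) hr
        rwa [inv_inv] at this
      have h2 : u⁻¹ * r * u ∉ Γ := fun h => hrΓ (by
        have := mul_mem (mul_mem hu h) (inv_mem hu)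
        simpa [mul_assoc] using this)
      have h3 := (apply_mem_positiveSide_conj u _ (mem_wallComplement.1 hx₀ _ h1)).2
        (hyr _ h1 h2)
      rw [show u * (u⁻¹ * r * u) * u⁻¹ = r by group] at h3
      exact mem_positiveSide_trans (hside u hu r hr hrΓ) h3
  refine ⟨u⁻¹, inv_mem hu, ?_⟩
  have h1 := hD _ (subset_closure huC)
  have h2 : dist y (u⁻¹ x₀) = dist x₀ (u y) := by
    rw [← u.dist_eq, dist_comm]
    simp
  have h3 := dist_triangle (ξ t) y (u⁻¹ x₀)
  have h4 := (Metric.mem_ball'.1 hy).le.trans (min_le_right _ _)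
  linarith

/-- The wall of `s ∈ S` contains a point of the closed chamber near which the positive side of
`s` is contained in the chamber. -/
theorem exists_mem_wall (hX : IsGeodesicSpace X) (hx₀ : x₀ ∈ wallComplement W)
    (hS : IsFundamentalSet W x₀ S) {s : X ≃ᵢ X} (hs : s ∈ S) :
    ∃ z ∈ wall s, z ∈ closure (chamber W x₀) ∧
      ∃ ε > 0, ∀ y ∈ Metric.ball z ε, y ∈ positiveSide x₀ s → y ∈ chamber W x₀ := by
  obtain ⟨hSR, hC, hmin⟩ := hS
  have hx₀' := mem_wallComplement.1 hx₀
  have hsub : chamber W x₀ ⊆ ⋂ s' ∈ S \ {s}, positiveSide x₀ s' := by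
    rw [hC]
    exact Set.biInter_subset_biInter_left Set.sdiff_subset
  obtain ⟨y, hy, hyC⟩ := Set.not_subset.1 fun h => hmin s hs (hsub.antisymm h)
  simp only [Set.mem_iInter] at hy
  have hmem : ∀ y, y ∈ positiveSide x₀ s → (∀ s' ∈ S \ {s}, y ∈ positiveSide x₀ s') →
      y ∈ chamber W x₀ := by
    intro y h1 h2
    rw [hC]
    simp only [Set.mem_iInter]
    intro s' hs'
    by_cases h : s' = s
    · rwa [h]
    · exact h2 s' ⟨hs', h⟩
  obtain ⟨ξ, hξ⟩ := hX x₀ y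
  have hopen := hX.isOpen_positiveSide x₀ s
  -- Minimality of `S` gave a point `y` that fails only the condition for `s`. The geodesic from
  -- `x₀` to `y` leaves the side of `s` at the desired wall point, still inside all the other sides
  -- by convexity.
  obtain ⟨t, ht, hz⟩ : ∃ t ∈ Set.Icc 0 (dist x₀ y),
      ξ t ∈ closure (positiveSide x₀ s) ∧ ξ t ∉ positiveSide x₀ s := by
    by_contra! hcon
    refine hyC (hmem y (hξ.isPreconnected_image.subset_of_closure_inter_subset hopen
      ⟨x₀, hξ.left_mem_image, self_mem_positiveSide (hx₀' s (hSR hs))⟩ ?_ hξ.right_mem_image) hy)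
    rintro _ ⟨h1, t, ht, rfl⟩
    exact hcon t ht h1
  have hwall : ξ t ∈ wall s := by
    by_contra hcon
    obtain ⟨a, ha, ha'⟩ := mem_closure_iff.1 hz.1 _ (hX.isOpen_positiveSide (ξ t) s)
      (self_mem_positiveSide hcon)
    exact hz.2 (mem_positiveSide_trans ha' (mem_positiveSide_symm hcon ha))
  obtain ⟨ε, hε, hball⟩ := hW.2.1.exists_ball_subset_positiveSide hX (ξ t)
  have hball' : ∀ y ∈ Metric.ball (ξ t) ε, y ∈ positiveSide x₀ s → y ∈ chamber W x₀ := by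
    intro v hv hvs
    refine hmem v hvs fun s' hs' => ?_
    have h0 := hx₀' s' (hSR hs'.1)
    have h1 := (hSR hs'.1).2.convex_positiveSide h0 _ (self_mem_positiveSide h0) _ (hy s' hs')
      ξ hξ t ht
    exact mem_positiveSide_trans h1 (hball s' (hSR hs'.1) (notMem_wall_of_mem h1) v hv)
  refine ⟨ξ t, hwall, ?_, ε, hε, hball'⟩
  rw [Metric.mem_closure_iff]
  intro δ hδ
  obtain ⟨v, hv, hv'⟩ := Metric.mem_closure_iff.1 hz.1 (min δ ε) (by positivity)
  exact ⟨v, hball' v (Metric.mem_ball'.2 (hv'.trans_le (min_le_right _ _))) hv,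
    hv'.trans_le (min_le_left _ _)⟩

theorem inversions_simple (hX : IsGeodesicSpace X) (hx₀ : x₀ ∈ wallComplement W)
    (hS : IsFundamentalSet W x₀ S) {s : X ≃ᵢ X} (hs : s ∈ S) : inversions W x₀ s = {s} := by
  have hsR := hS.1 hs
  have hx₀' := mem_wallComplement.1 hx₀
  ext r
  constructor
  swap
  · rintro rfl
    exact ⟨hsR, hsR.2.apply_notMem_positiveSide (hx₀' _ hsR)⟩
  rintro ⟨hr, hrs⟩
  by_contra hne
  have hne : r ≠ s := hne
  obtain ⟨z, hzs, hzC, ε, hε, hball⟩ := hW.exists_mem_wall hX hx₀ hS hs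
  obtain ⟨δ, hδ, hball'⟩ := hW.2.1.exists_ball_subset_positiveSide hX z
  obtain ⟨x, hxC, hx⟩ := Metric.mem_closure_iff.1 hzC (min ε δ) (by positivity)
  have hxε := hx.trans_le (min_le_left _ _)
  have hxδ := hx.trans_le (min_le_right _ _)
  obtain ⟨hxW, hxr⟩ := (mem_chamber_iff hX hx₀).1 hxC
  have hfix : ∀ {g : X ≃ᵢ X}, z ∈ wall g → ∀ v, dist z (g v) = dist z v := by
    intro g hg v
    conv_lhs => rw [← show g z = z from hg]
    exact g.dist_eq _ _
  -- If both walls pass through `z`, then near `z` the points `x` and `s (r x)` both lie in the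
  -- chamber, so `s * r = 1`. Otherwise `r` does not separate `x` from `s x` near `z`, hence does
  -- not separate `x₀` from `s x₀`.
  by_cases hz : z ∈ wall r
  · have hrxW := apply_mem_wallComplement hr.1 hxW
    have hsrxW := apply_mem_wallComplement hsR.1 hrxW
    have hrx : r x ∉ chamber W x₀ := fun h => by
      have h1 := ((mem_chamber_iff hX hx₀).1 h).2 r hr
      rw [positiveSide_eq (hxr r hr)] at h1
      exact hr.2.apply_notMem_positiveSide (mem_wallComplement.1 hxW r hr) h1
    have hrxs : r x ∉ positiveSide x₀ s := fun h =>
      hrx (hball _ (by rwa [Metric.mem_ball', hfix hz]) h)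
    have hsrx : s (r x) ∈ positiveSide x₀ s := by
      have h1 := mem_wallComplement.1 hrxW s hsR
      exact hsR.2.mem_positiveSide_of_notMem h1 (hx₀' s hsR)
        (mem_wallComplement.1 hsrxW s hsR)
        (fun h => hrxs (mem_positiveSide_symm h1 h)) (hsR.2.apply_notMem_positiveSide h1)
    have h2 := hball _ (by rwa [Metric.mem_ball', hfix hzs, hfix hz]) hsrx
    have h3 := hW.eq_one_of_apply_mem_chamber hx₀ (mul_mem hsR.1 hr.1) hxC h2
    refine hne ?_
    rw [← mul_right_inj s, h3, hsR.2.1]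
  · have h1 := hball' r hr hz x (Metric.mem_ball'.2 hxδ)
    have h2 := hball' r hr hz (s x) (by rwa [Metric.mem_ball', hfix hzs])
    have h3 : s x ∈ positiveSide x₀ r := by
      rw [positiveSide_eq (hxr r hr), ← positiveSide_eq h1]
      exact h2
    have hsrs : s⁻¹ * r * s ∈ reflections W := by
      have := conj_mem_reflections (inv_mem hsR.1) hr
      rwa [inv_inv] at this
    have h4 := (apply_mem_positiveSide_conj s _ (hx₀' _ hsrs)).2 (hxr _ hsrs)
    rw [show s * (s⁻¹ * r * s) * s⁻¹ = r by group] at h4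
    have h5 := mem_wallComplement.1 (apply_mem_wallComplement hsR.1 hx₀) r hr
    exact hrs (mem_positiveSide_trans h3 (mem_positiveSide_symm h5 h4))

theorem isInversionCocycle (hX : IsGeodesicSpace X) (hx₀ : x₀ ∈ wallComplement W)
    (hS : IsFundamentalSet W x₀ S) : IsInversionCocycle W S (inversions W x₀) where
  subset _ hs := (hS.1 hs).1
  mul_self _ hs := (hS.1 hs).2.1
  cocycle _ hg _ hh r := mem_inversions_mul hx₀ hg hh r
  simple _ hs := hW.inversions_simple hX hx₀ hS hs

/-- Some `u` in W_S moves `w x₀` to the positive side of every `s ∈ S`, that is, into the chamber;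
then `u * w = 1` because chamber stabilizers are trivial. -/
theorem parabolic_eq (hX : IsGeodesicSpace X) (hx₀ : x₀ ∈ wallComplement W)
    (hS : IsFundamentalSet W x₀ S) : parabolic S = W := by
  have hle : parabolic S ≤ W := (hW.isInversionCocycle hX hx₀ hS).parabolic_le subset_rfl
  refine hle.antisymm fun w hw => ?_
  obtain ⟨u, hu, h⟩ := hW.2.1.exists_apply_mem_positiveSide hX hle hx₀
    (apply_mem_wallComplement hw hx₀)
  have h1 : (u * w) x₀ ∈ chamber W x₀ := by
    rw [hS.2.1]
    simp only [Set.mem_iInter]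
    exact fun s hs => h s (hS.1 hs) (Subgroup.subset_closure hs)
  have h2 := hW.eq_one_of_apply_mem_chamber hx₀ (mul_mem (hle hu) hw) (self_mem_chamber hx₀) h1
  rw [← mul_mem_cancel_left hu, h2]
  exact one_mem _

/-- Each `s ∈ S` fixes a point of the closed chamber and so moves `x₀` by a bounded amount. -/
theorem finite_fundamentalSet (hX : IsGeodesicSpace X) (hx₀ : x₀ ∈ wallComplement W)
    (hS : IsFundamentalSet W x₀ S) : S.Finite := by
  obtain ⟨D, -, hD⟩ := hW.exists_dist_le_of_mem_chamber hx₀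
  refine (hW.2.1.finite_dist_le x₀ x₀ (2 * D)).subset fun s hs => ⟨(hS.1 hs).1, ?_⟩
  obtain ⟨z, hz, hzC, -⟩ := hW.exists_mem_wall hX hx₀ hS hs
  have h1 := hD z hzC
  have h2 : dist (s x₀) z = dist x₀ z := by
    conv_lhs => rw [← show s z = z from hz]
    exact s.dist_eq _ _
  have h3 := dist_triangle (s x₀) z x₀
  rw [dist_comm z] at h3
  linarith

end IsCocompactDiscreteReflectionGroup

end Coxeter

/-! ### Convexity of the metric of a CAT(0) space -/

section Convexity

variable {X : Type*} [MetricSpace X]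

theorem exists_comparison_triangle {a b c : ℝ} (ha : 0 ≤ a) (hb : 0 ≤ b) (hc : 0 ≤ c)
    (habc : a ≤ b + c) (hbac : b ≤ a + c) (hcab : c ≤ a + b) :
    ∃ p q r : EuclideanSpace ℝ (Fin 2), dist p q = a ∧ dist p r = b ∧ dist q r = c := by
  obtain ⟨u, v, h1, h2⟩ : ∃ u v : ℝ, u ^ 2 + v ^ 2 = b ^ 2 ∧ (a - u) ^ 2 + v ^ 2 = c ^ 2 := by
    rcases ha.eq_or_lt with rfl | ha
    · exact ⟨b, 0, by ring, by rw [show b = c by linarith]; ring⟩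
    · have hu : 2 * a * ((a ^ 2 + b ^ 2 - c ^ 2) / (2 * a)) = a ^ 2 + b ^ 2 - c ^ 2 := by
        field_simp
      set u := (a ^ 2 + b ^ 2 - c ^ 2) / (2 * a)
      have h3 : u ≤ b := by
        by_contra! h
        nlinarith [mul_lt_mul_of_pos_left h (by positivity : 0 < 2 * a),
          mul_nonneg (sub_nonneg.2 habc) (by linarith : 0 ≤ c + a - b),
          mul_nonneg (by linarith : 0 ≤ c + b - a) (by linarith : 0 ≤ c + a - b)]
      have h4 : -b ≤ u := by
        by_contra! h
        nlinarith [mul_lt_mul_of_pos_left h (by positivity : 0 < 2 * a),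
          mul_nonneg (by linarith : 0 ≤ a + b - c) (by linarith : 0 ≤ c + a + b)]
      have h5 : 0 ≤ b ^ 2 - u ^ 2 := sub_nonneg.2 (sq_le_sq' h4 h3)
      refine ⟨u, √(b ^ 2 - u ^ 2), ?_, ?_⟩ <;> rw [Real.sq_sqrt h5]
      · ring
      · linarith
  refine ⟨!₂[0, 0], !₂[a, 0], !₂[u, v], ?_, ?_, ?_⟩ <;>
    simp only [EuclideanSpace.dist_eq, Fin.sum_univ_two, Real.dist_eq, sq_abs] <;> simp
  · exact Real.sqrt_sq ha
  · rw [h1, Real.sqrt_sq hb]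
  · rw [h2, Real.sqrt_sq hc]

theorem lineMap_mul_div_cancel (p q : EuclideanSpace ℝ (Fin 2)) (s : ℝ) :
    AffineMap.lineMap (k := ℝ) p q (s * dist p q / dist p q) = AffineMap.lineMap p q s := by
  by_cases h : dist p q = 0
  · rw [dist_eq_zero.1 h, AffineMap.lineMap_same, AffineMap.const_apply, AffineMap.const_apply]
  · rw [mul_div_cancel_right₀ _ h]

namespace IsGeodesic

variable {ξ : ℝ → X} {x y : X}

theorem initial (h : IsGeodesic ξ x y) {t : ℝ} (ht : t ∈ Set.Icc 0 (dist x y)) :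
    IsGeodesic ξ x (ξ t) := by
  have h1 := h.dist_left ht
  refine ⟨h.1, by rw [h1], fun s hs u hu => ?_⟩
  rw [h1] at hs hu
  exact h.2.2 s ⟨hs.1, hs.2.trans ht.2⟩ u ⟨hu.1, hu.2.trans ht.2⟩

end IsGeodesic

theorem mul_mem_Icc {s d : ℝ} (hs : s ∈ Set.Icc (0 : ℝ) 1) (hd : 0 ≤ d) : s * d ∈ Set.Icc 0 d :=
  ⟨mul_nonneg hs.1 hd, mul_le_of_le_one_left hd hs.2⟩

namespace IsCAT0

variable (hX : IsCAT0 X)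

include hX

theorem dist_le_of_common_origin {ξ η : ℝ → X} {p q r : X} (hξ : IsGeodesic ξ p q)
    (hη : IsGeodesic η p r) {s : ℝ} (hs : s ∈ Set.Icc (0 : ℝ) 1) :
    dist (ξ (s * dist p q)) (η (s * dist p r)) ≤ s * dist q r := by
  obtain ⟨p', q', r', h1, h2, h3⟩ := exists_comparison_triangle (dist_nonneg (x := p) (y := q))
    (dist_nonneg (x := p) (y := r)) (dist_nonneg (x := q) (y := r))
    (by rw [dist_comm q r]; exact dist_triangle p r q) (dist_triangle p q r)
    (by rw [dist_comm p q]; exact dist_triangle q p r)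
  refine (hX.2 p q r ξ η hξ hη p' q' r' h1 h2 h3 _ (mul_mem_Icc hs dist_nonneg) _
    (mul_mem_Icc hs dist_nonneg)).trans_eq ?_
  rw [← h1, ← h2, lineMap_mul_div_cancel, lineMap_mul_div_cancel, dist_eq_norm,
    AffineMap.lineMap_apply_module', AffineMap.lineMap_apply_module',
    show s • (q' - p') + p' - (s • (r' - p') + p') = s • (q' - r') by module, norm_smul,
    Real.norm_of_nonneg hs.1, ← dist_eq_norm, h3]

/-- The distance between two geodesics is convex. -/
theorem dist_le {ξ η : ℝ → X} {p q p' q' : X} (hξ : IsGeodesic ξ p q)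
    (hη : IsGeodesic η p' q') {s : ℝ} (hs : s ∈ Set.Icc (0 : ℝ) 1) :
    dist (ξ (s * dist p q)) (η (s * dist p' q')) ≤ (1 - s) * dist p p' + s * dist q q' := by
  -- The diagonal splits the quadrilateral into two triangles, with common origins `p` and `q'`.
  obtain ⟨ζ, hζ⟩ := hX.1 p q'
  have h1 := hX.dist_le_of_common_origin hξ hζ hs
  have h2 := hX.dist_le_of_common_origin hζ.reverse hη.reverse (s := 1 - s)
    ⟨by linarith [hs.2], by linarith [hs.1]⟩
  rw [dist_comm q' p, dist_comm q' p',
    show dist p q' - (1 - s) * dist p q' = s * dist p q' by ring,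
    show dist p' q' - (1 - s) * dist p' q' = s * dist p' q' by ring] at h2
  linarith [dist_triangle (ξ (s * dist p q)) (ζ (s * dist p q')) (η (s * dist p' q'))]

/-- Two geodesics with the same origin that are close at late times are very close at early
times. -/
theorem dist_le_div_mul {ξ η : ℝ → X} {p q q' : X} (hξ : IsGeodesic ξ p q)
    (hη : IsGeodesic η p q') {r s R : ℝ} (hr : 0 ≤ r) (hrq : r ≤ dist p q)
    (hs : s ∈ Set.Icc 0 (dist p q)) (hR : 0 < R) (hRq : R ≤ dist p q') (hrR : r ≤ R) :
    dist (ξ r) (η r) ≤ 2 * (r / R * dist (ξ s) (η R)) := by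
  have hRm : R ∈ Set.Icc 0 (dist p q') := ⟨hR.le, hRq⟩
  have hσ : r / R ∈ Set.Icc (0 : ℝ) 1 := ⟨by positivity, (div_le_one hR).2 hrR⟩
  have h1 := hX.dist_le_of_common_origin (hξ.initial hs) (hη.initial hRm) hσ
  rw [hξ.dist_left hs, hη.dist_left hRm, div_mul_cancel₀ _ hR.ne'] at h1
  -- Scaling by `r / R` sends `η R` to `η r` but `ξ s` only to `ξ (r / R * s)`. The parameter error
  -- is bounded by the same distance, whence the factor 2.
  have h2 : |R - s| ≤ dist (ξ s) (η R) := by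
    have a1 := hξ.dist_left hs
    have a2 := hη.dist_left hRm
    have a3 := dist_triangle p (ξ s) (η R)
    have a4 := dist_triangle_right p (ξ s) (η R)
    rw [abs_le]
    constructor <;> linarith
  have hs' : r / R * s ∈ Set.Icc 0 (dist p q) :=
    ⟨mul_nonneg hσ.1 hs.1, (mul_le_of_le_one_left hs.1 hσ.2).trans hs.2⟩
  have h3 := hξ.2.2 r ⟨hr, hrq⟩ _ hs'
  rw [show r - r / R * s = r / R * (R - s) by field_simp, abs_mul, abs_of_nonneg hσ.1] at h3
  have h4 := mul_le_mul_of_nonneg_left h2 hσ.1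
  linarith [dist_triangle (ξ r) (ξ (r / R * s)) (η r)]

end IsCAT0

end Convexity

/-! ### Rays in a proper CAT(0) space -/

section Rays

variable {X : Type*} [MetricSpace X]

namespace GeodesicRay

theorem dist_eq (c : GeodesicRay X) (s t : ℝ≥0) : dist (c.toFun s) (c.toFun t) = |(s : ℝ) - t| := by
  rw [c.isometry.dist_eq, NNReal.dist_eq]

theorem dist_zero (c : GeodesicRay X) (t : ℝ≥0) : dist (c.toFun 0) (c.toFun t) = t := by
  rw [c.dist_eq, NNReal.coe_zero, zero_sub, abs_neg, NNReal.abs_eq]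

theorem isGeodesic (c : GeodesicRay X) (t : ℝ≥0) :
    IsGeodesic (fun s => c.toFun s.toNNReal) (c.toFun 0) (c.toFun t) := by
  refine ⟨by simp, by simp [c.dist_zero], fun s hs u hu => ?_⟩
  rw [c.dist_eq, Real.coe_toNNReal _ hs.1, Real.coe_toNNReal _ hu.1]

theorem endpoint_eq_iff {c c' : GeodesicRay X} :
    c.endpoint = c'.endpoint ↔ ∃ K : ℝ, ∀ t : ℝ≥0, dist (c.toFun t) (c'.toFun t) ≤ K :=
  Quotient.eq

end GeodesicRay

/-- A pointwise ultralimit of longer and longer geodesics issuing from a point is a ray. -/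
theorem exists_limit_ray [ProperSpace X] {p : X} {a : ℕ → X} {ξ : ℕ → ℝ → X}
    (hξ : ∀ n, IsGeodesic (ξ n) p (a n)) (ha : ∀ n : ℕ, n ≤ dist p (a n)) :
    ∃ c : GeodesicRay X, c.toFun 0 = p ∧
      ∀ t : ℝ≥0, Filter.Tendsto (fun n => ξ n t) (Filter.hyperfilter ℕ : Filter ℕ)
        (nhds (c.toFun t)) := by
  have hev : ∀ t : ℝ≥0, ∀ᶠ n in (Filter.hyperfilter ℕ : Filter ℕ),
      (t : ℝ) ∈ Set.Icc 0 (dist p (a n)) := by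
    intro t
    refine Filter.Eventually.filter_mono Nat.hyperfilter_le_atTop ?_
    filter_upwards [Filter.eventually_ge_atTop ⌈(t : ℝ)⌉₊] with n hn
    exact ⟨t.2, (Nat.ceil_le.1 hn).trans (ha n)⟩
  -- One ultrafilter gives convergence at all times simultaneously, by compactness of closed balls.
  have hlim : ∀ t : ℝ≥0, ∃ z, Filter.Tendsto (fun n => ξ n t) (Filter.hyperfilter ℕ : Filter ℕ)
      (nhds z) := by
    intro t
    obtain ⟨z, -, hz⟩ := (isCompact_closedBall p (t : ℝ)).ultrafilter_le_nhds'
      ((Filter.hyperfilter ℕ).map fun n => ξ n t) (Ultrafilter.mem_map.2 (by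
        filter_upwards [hev t] with n hn
        rw [Set.mem_preimage, Metric.mem_closedBall', (hξ n).dist_left hn]))
    exact ⟨z, hz⟩
  choose c hc using hlim
  have hiso : Isometry c := by
    refine Isometry.of_dist_eq fun s t => ?_
    refine tendsto_nhds_unique ((hc s).dist (hc t)) (tendsto_const_nhds.congr' ?_)
    filter_upwards [hev s, hev t] with n hs ht
    rw [(hξ n).2.2 _ hs _ ht, NNReal.dist_eq]
  refine ⟨⟨c, hiso⟩, ?_, hc⟩
  refine tendsto_nhds_unique (hc 0) (tendsto_const_nhds.congr fun n => ?_)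
  rw [NNReal.coe_zero, (hξ n).1]

namespace IsCAT0

variable (hX : IsCAT0 X)

include hX

theorem ray_eq {c c' : GeodesicRay X} (h0 : c.toFun 0 = c'.toFun 0)
    (h : c.endpoint = c'.endpoint) (t : ℝ≥0) : c.toFun t = c'.toFun t := by
  obtain ⟨K, hK⟩ := GeodesicRay.endpoint_eq_iff.1 h
  by_contra hne
  have hd := dist_pos.2 hne
  set d := dist (c.toFun t) (c'.toFun t)
  have hK0 : 0 ≤ K := dist_nonneg.trans (hK 0)
  -- Chosen so that `d * R > 2 * t * K`, which contradicts the bound for rays staying within `K`.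
  let R : ℝ≥0 := t + 1 + ⟨2 * t * K / d, by positivity⟩
  have hRv : (R : ℝ) = t + 1 + 2 * t * K / d := rfl
  have hR : (0 : ℝ) < R := by rw [hRv]; positivity
  have htR : (t : ℝ) ≤ R := by
    rw [hRv]
    have : 0 ≤ 2 * t * K / d := by positivity
    linarith
  have h1 := hX.dist_le_div_mul (c.isGeodesic R) (h0 ▸ c'.isGeodesic R) (r := t) (s := R) (R := R)
    t.2 (by rwa [c.dist_zero]) ⟨hR.le, by rw [c.dist_zero]⟩ hR (by rw [h0, c'.dist_zero]) htR
  simp only [Real.toNNReal_coe] at h1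
  have h2 : 2 * (t / R * dist (c.toFun R) (c'.toFun R)) ≤ 2 * (t / R * K) := by
    gcongr
    exact hK R
  have h3 : d * R ≤ 2 * t * K := by
    calc d * R ≤ 2 * (t / R * K) * R := by gcongr; exact h1.trans h2
      _ = 2 * t * K := by field_simp
  rw [hRv, mul_add, mul_div_cancel₀ _ hd.ne'] at h3
  have : 0 < d * ((t : ℝ) + 1) := by positivity
  linarith

/-- Every boundary point is the endpoint of a ray issuing from a given point. -/
theorem exists_ray [ProperSpace X] (q : X) (α : Boundary X) :
    ∃ c : GeodesicRay X, c.toFun 0 = q ∧ c.endpoint = α := by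
  obtain ⟨c, rfl⟩ : ∃ c : GeodesicRay X, c.endpoint = α := Quotient.exists_rep α
  set D := nndist (c.toFun 0) q with hD
  have hD' : dist (c.toFun 0) q = D := rfl
  have hD'' : dist q (c.toFun 0) = D := by rw [dist_comm, hD']
  -- The margin `D` keeps `c (T n)` at distance at least `n + 1` from `q`. The final bound `D + D`
  -- is one `D` from convexity and one from the mismatch between `T n` and `dist q (c (T n))`.
  let T : ℕ → ℝ≥0 := fun n => n + 1 + D
  have hT : ∀ n, (T n : ℝ) = n + 1 + D := fun n => by simp [T]
  have hlow : ∀ n : ℕ, (n : ℝ) + 1 ≤ dist q (c.toFun (T n)) := fun n => by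
    have := dist_triangle (c.toFun 0) q (c.toFun (T n))
    rw [c.dist_zero, hT, hD'] at this
    linarith
  choose ξ hξ using fun n => hX.1 q (c.toFun (T n))
  obtain ⟨c', h0, hlim⟩ := exists_limit_ray hξ fun n => by linarith [hlow n]
  refine ⟨c', h0, GeodesicRay.endpoint_eq_iff.2 ⟨D + D, fun t => ?_⟩⟩
  refine le_of_tendsto ((hlim t).dist tendsto_const_nhds) ?_
  refine Filter.Eventually.filter_mono Nat.hyperfilter_le_atTop ?_
  filter_upwards [Filter.eventually_ge_atTop ⌈(t : ℝ)⌉₊] with n hn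
  have htn : (t : ℝ) ≤ n := Nat.ceil_le.1 hn
  have hl := hlow n
  have hup : |T n - dist q (c.toFun (T n))| ≤ D := by
    have a1 := dist_triangle (c.toFun 0) q (c.toFun (T n))
    have a2 := dist_triangle q (c.toFun 0) (c.toFun (T n))
    rw [c.dist_zero] at a1 a2
    rw [abs_le]
    constructor <;> linarith
  set l := dist q (c.toFun (T n)) with hl_def
  have hlpos : 0 < l := by linarith [n.cast_nonneg (α := ℝ)]
  have hσ : t / l ∈ Set.Icc (0 : ℝ) 1 := ⟨by positivity, (div_le_one hlpos).2 (by linarith)⟩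
  have h1 := hX.dist_le (hξ n) (c.isGeodesic (T n)) hσ
  have h2 : dist (c.toFun (t / l * T n).toNNReal) (c.toFun t) ≤ D := by
    rw [c.dist_eq, Real.coe_toNNReal _ (mul_nonneg hσ.1 (T n).coe_nonneg),
      show t / l * T n - t = t / l * (T n - l) by field_simp, abs_mul, abs_of_nonneg hσ.1]
    exact (mul_le_of_le_one_left (abs_nonneg _) hσ.2).trans hup
  rw [← hl_def, div_mul_cancel₀ _ hlpos.ne', c.dist_zero, dist_self, mul_zero, add_zero, hD''] at h1
  have h3 : (1 - t / l) * D ≤ D := mul_le_of_le_one_left D.2 (by linarith [hσ.1])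
  linarith [dist_triangle (ξ n t) (c.toFun (t / l * T n).toNNReal) (c.toFun t)]

end IsCAT0

end Rays

/-! ### Limit points -/

section LimitPoints

variable {X : Type*} [MetricSpace X]

/-- The boundary points in the closure of a subset `A`, for the cone topology based at `p`. -/
def limitPoints (p : X) (A : Set X) : Set (Boundary X) :=
  {α | Sum.inr α ∈ @closure (X ⊕ Boundary X) (coneTopology p) (Sum.inl '' A)}

namespace IsCAT0

variable (hX : IsCAT0 X)

include hX

/-- The cone neighbourhoods centred at `c` itself suffice: inside `X`, every open set containing the
endpoint contains one of them, by induction on the generation of the topology. Uniqueness of rays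
handles the generators. -/
theorem endpoint_mem_limitPoints_iff {p : X} {A : Set X} {c : GeodesicRay X}
    (hc : c.toFun 0 = p) :
    c.endpoint ∈ limitPoints p A ↔ ∀ r : ℝ≥0, 0 < r → ∀ ε : ℝ, 0 < ε →
      ∃ a ∈ A, r < dist p a ∧ ∃ ξ, IsGeodesic ξ p a ∧ dist (ξ r) (c.toFun r) < ε := by
  let := coneTopology p
  rw [limitPoints, Set.mem_ofPred_eq, mem_closure_iff]
  constructor
  · intro h r hr ε hε
    obtain ⟨_, h1, a, ha, rfl⟩ := h (coneNhd p c r ε)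
      (TopologicalSpace.isOpen_generateFrom_of_mem (Or.inr ⟨c, r, ε, hc, hr, hε, rfl⟩))
      (Or.inr ⟨_, ⟨c, hc, rfl, by simpa⟩, rfl⟩)
    rcases h1 with ⟨a', h1, h2⟩ | ⟨a', -, h2⟩
    · obtain rfl := Sum.inl_injective h2
      exact ⟨_, ha, h1⟩
    · cases h2
  · intro h o ho hco
    obtain ⟨R, hR, δ, hδ, key⟩ : ∃ R : ℝ≥0, 0 < R ∧ ∃ δ : ℝ, 0 < δ ∧ ∀ a, R < dist p a →
        (∃ ξ, IsGeodesic ξ p a ∧ dist (ξ R) (c.toFun R) < δ) → Sum.inl a ∈ o := by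
      clear h
      induction ho with
      | basic s hs =>
        rcases hs with ⟨O, -, rfl⟩ | ⟨c₁, r, ε, h0, hr, hε, rfl⟩
        · obtain ⟨_, _, h1⟩ := hco
          cases h1
        · rcases hco with ⟨_, _, h1⟩ | ⟨α, ⟨c', h1, h2, h3⟩, h4⟩
          · cases h1
          · obtain rfl := Sum.inr_injective h4
            rw [hX.ray_eq (h1.trans hc.symm) h2] at h3
            refine ⟨r, hr, ε - dist (c.toFun r) (c₁.toFun r), sub_pos.2 h3, ?_⟩
            rintro a ha ⟨ξ, hξ, h5⟩
            refine Or.inl ⟨a, ⟨ha, ξ, hξ, ?_⟩, rfl⟩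
            linarith [dist_triangle (ξ r) (c.toFun r) (c₁.toFun r)]
      | univ => exact ⟨1, one_pos, 1, one_pos, fun _ _ _ => trivial⟩
      | inter s t _ _ ihs iht =>
        obtain ⟨R₁, hR₁, δ₁, hδ₁, h1⟩ := ihs hco.1
        obtain ⟨R₂, hR₂, δ₂, hδ₂, h2⟩ := iht hco.2
        -- Closeness at the larger radius passes to the smaller one at the cost of a factor 2.
        have hδ : 0 < min δ₁ δ₂ / 2 := by positivity
        have hR : 0 < max R₁ R₂ := lt_max_of_lt_left hR₁
        refine ⟨max R₁ R₂, hR, min δ₁ δ₂ / 2, hδ, ?_⟩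
        rintro a ha ⟨ξ, hξ, h3⟩
        have key : ∀ r : ℝ≥0, r ≤ max R₁ R₂ → dist (ξ r) (c.toFun r) < min δ₁ δ₂ := by
          intro r hr
          have hr' : (r : ℝ) ≤ (max R₁ R₂ : ℝ≥0) := NNReal.coe_le_coe.2 hr
          have hR' : (0 : ℝ) < (max R₁ R₂ : ℝ≥0) := NNReal.coe_pos.2 hR
          have h4 := hX.dist_le_div_mul hξ (hc ▸ c.isGeodesic (max R₁ R₂)) (r := r)
            r.2 (hr'.trans ha.le) ⟨hR'.le, ha.le⟩ hR' (by rw [← hc, c.dist_zero]) hr'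
          simp only [Real.toNNReal_coe] at h4
          have h5 : (r : ℝ) / (max R₁ R₂ : ℝ≥0) ≤ 1 := (div_le_one hR').2 hr'
          have h6 := mul_le_of_le_one_left (dist_nonneg (x := ξ (max R₁ R₂ : ℝ≥0))
            (y := c.toFun (max R₁ R₂))) h5
          linarith
        refine ⟨h1 a (lt_of_le_of_lt (NNReal.coe_le_coe.2 (le_max_left _ _)) ha)
          ⟨ξ, hξ, (key _ (le_max_left _ _)).trans_le (min_le_left _ _)⟩,
          h2 a (lt_of_le_of_lt (NNReal.coe_le_coe.2 (le_max_right _ _)) ha)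
          ⟨ξ, hξ, (key _ (le_max_right _ _)).trans_le (min_le_right _ _)⟩⟩
      | sUnion S _ ih =>
        obtain ⟨s, hs, hcs⟩ := hco
        obtain ⟨R, hR, δ, hδ, h1⟩ := ih s hs hcs
        exact ⟨R, hR, δ, hδ, fun a ha h2 => ⟨s, hs, h1 a ha h2⟩⟩
    obtain ⟨a, ha, h1, h2⟩ := h R hR δ hδ
    exact ⟨_, key a h1 h2, a, ha, rfl⟩

/-- Limit points depend neither on the base point nor on bounded perturbations of the set. -/
theorem limitPoints_subset [ProperSpace X] {A B : Set X} {K : ℝ}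
    (hAB : ∀ a ∈ A, ∃ b ∈ B, dist a b ≤ K) (p q : X) : limitPoints p A ⊆ limitPoints q B := by
  intro α hα
  obtain ⟨c, hc, rfl⟩ := hX.exists_ray p α
  obtain ⟨c', hc', hcc'⟩ := hX.exists_ray q c.endpoint
  obtain ⟨K₁, hK₁⟩ := GeodesicRay.endpoint_eq_iff.1 hcc'
  rw [← hcc', hX.endpoint_mem_limitPoints_iff hc']
  rw [hX.endpoint_mem_limitPoints_iff hc] at hα
  intro r hr ε hε
  have hK₁0 : 0 ≤ K₁ := dist_nonneg.trans (hK₁ 0)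
  have hr' : (0 : ℝ) < r := hr
  -- `M` bounds the gap between the geodesic to `b` and the ray `c'` near radius `R`. `R` is large
  -- enough for `2 * r * M / R ≤ ε` and for `b` to lie beyond radius `r` from `q`.
  let M := dist p q + |K| + 1 + K₁
  have hM : 0 < M := by positivity
  let R : ℝ≥0 := r + ⟨dist p q + |K| + 2 * r * M / ε, by positivity⟩
  have hRv : (R : ℝ) = r + (dist p q + |K| + 2 * r * M / ε) := rfl
  have hpos : 0 ≤ 2 * r * M / ε := by positivity
  have hpos' := dist_nonneg (x := p) (y := q)
  have hrR : (r : ℝ) ≤ R := by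
    rw [hRv]
    linarith [abs_nonneg K]
  have hR : (0 : ℝ) < R := hr'.trans_le hrR
  obtain ⟨a, ha, hRa, ξ, hξ, h1⟩ := hα R (NNReal.coe_pos.1 hR) 1 one_pos
  obtain ⟨b, hb, hab⟩ := hAB a ha
  obtain ⟨η, hη⟩ := hX.1 q b
  have habs := le_abs_self K
  have hqb : r < dist q b := by
    have := dist_triangle4 p q b a
    rw [dist_comm b a] at this
    linarith
  refine ⟨b, hb, hqb, η, hη, ?_⟩
  have hpa : 0 < dist p a := hR.trans hRa
  have hσ : R / dist p a ∈ Set.Icc (0 : ℝ) 1 := ⟨by positivity, (div_le_one hpa).2 hRa.le⟩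
  have h2 := hX.dist_le hξ hη hσ
  rw [div_mul_cancel₀ _ hpa.ne'] at h2
  have h3 : (1 - R / dist p a) * dist p q ≤ dist p q :=
    mul_le_of_le_one_left dist_nonneg (by linarith [hσ.1])
  have h4 : R / dist p a * dist a b ≤ dist a b := mul_le_of_le_one_left dist_nonneg hσ.2
  set s := R / dist p a * dist q b
  have h5 : dist (η s) (c'.toFun R) < M := by
    have a1 := dist_triangle4 (η s) (ξ R) (c.toFun R) (c'.toFun R)
    have a2 := hK₁ R
    rw [dist_comm (c'.toFun R)] at a2
    rw [dist_comm (η s) (ξ R)] at a1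
    simp only [M]
    linarith
  have h6 := hX.dist_le_div_mul hη (hc' ▸ c'.isGeodesic R) (r := r) (s := s) (R := R)
    r.2 hqb.le (mul_mem_Icc hσ dist_nonneg) hR (by rw [← hc', c'.dist_zero]) hrR
  simp only [Real.toNNReal_coe] at h6
  refine h6.trans_lt ?_
  have h7 : (r : ℝ) / R * dist (η s) (c'.toFun R) < r / R * M :=
    mul_lt_mul_of_pos_left h5 (by positivity)
  have h8 : 2 * (r / R * M) ≤ ε := by
    rw [show 2 * (r / R * M) = 2 * r * M / R by ring, div_le_iff₀ hR, ← div_le_iff₀' hε, hRv]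
    linarith [abs_nonneg K]
  linarith

theorem boundaryMap_mem_limitPoints [ProperSpace X] (w : X ≃ᵢ X) {p : X} {A : Set X}
    {α : Boundary X} (hα : α ∈ limitPoints p A) :
    boundaryMap w α ∈ limitPoints (w p) (w '' A) := by
  obtain ⟨c, hc, rfl⟩ := hX.exists_ray p α
  have hwc : (c.map w).toFun 0 = w p := congrArg w hc
  change (c.map w).endpoint ∈ _
  rw [hX.endpoint_mem_limitPoints_iff hwc]
  rw [hX.endpoint_mem_limitPoints_iff hc] at hα
  intro r hr ε hε
  obtain ⟨a, ha, h1, ξ, hξ, h2⟩ := hα r hr ε hε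
  refine ⟨w a, ⟨a, ha, rfl⟩, by rwa [w.dist_eq], w ∘ ξ, hξ.comp_isometryEquiv w, ?_⟩
  change dist (w (ξ r)) (w (c.toFun r)) < ε
  rwa [w.dist_eq]

end IsCAT0

end LimitPoints

/-! ### Limit sets of parabolic subgroups -/

section Index

variable {G : Type*} [Group G] {H K : Subgroup G}

theorem relIndex_ne_zero_of_finite (hHK : H ≤ K) {F : Set G} (hF : F.Finite)
    (h : ∀ w ∈ K, ∃ u ∈ H, u⁻¹ * w ∈ F) : H.relIndex K ≠ 0 := by
  have hF' : {k : K | (k : G)⁻¹ ∈ F}.Finite :=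
    hF.preimage (f := fun k : K => (k : G)⁻¹)
      (inv_injective.comp Subtype.val_injective).injOn
  have hfin : Finite (K ⧸ H.subgroupOf K) := by
    refine Set.finite_univ_iff.1 ((hF'.image (QuotientGroup.mk (s := H.subgroupOf K))).subset ?_)
    rintro q -
    obtain ⟨w, rfl⟩ := QuotientGroup.mk_surjective q
    -- The hypothesis covers `K` by right cosets of `H`; inversion turns them into the left cosets
    -- of the quotient.
    obtain ⟨u, hu, hf⟩ := h (w⁻¹ : K) (w⁻¹ : K).2
    refine ⟨w * ⟨u, hHK hu⟩, by simpa using hf, ?_⟩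
    rw [QuotientGroup.eq, Subgroup.mem_subgroupOf]
    simpa using hu
  exact Subgroup.index_ne_zero_of_finite (H := H.subgroupOf K)

end Index

/-! ### Limit sets, finite index and escaping rays -/

section LimitSets

variable {X : Type*} [MetricSpace X] {W H K : Subgroup (X ≃ᵢ X)}

theorem limitSet_eq_limitPoints (H : Subgroup (X ≃ᵢ X)) (p : X) :
    limitSet H p = limitPoints p {x | ∃ γ ∈ H, γ p = x} := rfl

theorem dist_apply_apply (u w : X ≃ᵢ X) (x y : X) : dist (u x) (w y) = dist ((w⁻¹ * u) x) y := by
  rw [← (w⁻¹).dist_eq]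
  simp

/-- If `H` has infinite index in `K`, then the orbit of `K` leaves every neighbourhood of the orbit
of `H`. -/
theorem IsProperAction.exists_far (hP : IsProperAction W) (hHK : H ≤ K) (hK : K ≤ W)
    (hind : H.relIndex K = 0) (x : X) (M : ℝ) : ∃ w ∈ K, ∀ u ∈ H, M < dist (w x) (u x) := by
  by_contra! hcon
  refine relIndex_ne_zero_of_finite hHK (hP.finite_dist_le x x M) (fun w hw => ?_) hind
  obtain ⟨u, hu, h⟩ := hcon w hw
  exact ⟨u, hu, hK (mul_mem (inv_mem (hHK hu)) hw), by rwa [← dist_apply_apply]⟩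

theorem exists_near_of_relIndex_ne_zero (hind : H.relIndex K ≠ 0) (p : X) :
    ∃ M : ℝ, ∀ w ∈ K, ∃ u ∈ H, dist (w p) (u p) ≤ M := by
  have hfin : Finite (K ⧸ H.subgroupOf K) := Nat.finite_of_card_ne_zero hind
  obtain ⟨M, hM⟩ := (Set.finite_range fun q : K ⧸ H.subgroupOf K =>
    dist (((q.out : K) : X ≃ᵢ X)⁻¹ p) p).bddAbove
  refine ⟨M, fun w hw => ?_⟩
  let w' : K := ⟨w, hw⟩
  let q : K ⧸ H.subgroupOf K := QuotientGroup.mk w'⁻¹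
  have h1 : q.out⁻¹ * w'⁻¹ ∈ H.subgroupOf K := by
    rw [← QuotientGroup.eq, QuotientGroup.out_eq']
  refine ⟨w * ((q.out : K) : X ≃ᵢ X), ?_, ?_⟩
  · have h2 : ((q.out : K) : X ≃ᵢ X)⁻¹ * w⁻¹ ∈ H := h1
    simpa using inv_mem h2
  · rw [dist_apply_apply]
    have h2 := hM ⟨q, rfl⟩
    simpa using h2

namespace IsCAT0

variable (hX : IsCAT0 X) [ProperSpace X]

include hX

theorem limitSet_eq_of_relIndex_ne_zero (hHK : H ≤ K) (hind : H.relIndex K ≠ 0) (p q : X) :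
    limitSet K p = limitSet H q := by
  obtain ⟨M, hM⟩ := exists_near_of_relIndex_ne_zero hind p
  have hbase : ∀ u : X ≃ᵢ X, dist (u p) (u q) = dist p q := fun u => u.dist_eq _ _
  refine Set.Subset.antisymm ?_ ?_
  · refine hX.limitPoints_subset (K := M + dist p q) ?_ p q
    rintro _ ⟨w, hw, rfl⟩
    obtain ⟨u, hu, h⟩ := hM w hw
    exact ⟨u q, ⟨u, hu, rfl⟩, by linarith [dist_triangle (w p) (u p) (u q), hbase u]⟩
  · refine hX.limitPoints_subset (K := dist q p) ?_ q p
    rintro _ ⟨u, hu, rfl⟩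
    exact ⟨u p, ⟨u, hHK hu, rfl⟩, (u.dist_eq _ _).le⟩

/-- If the elements of `W` normalize `H`, then the limit set of `H` is invariant under `W`. -/
theorem isInvariant_limitSet (h : ∀ w ∈ W, ∀ γ ∈ H, w * γ * w⁻¹ ∈ H) (p : X) :
    IsInvariant W (limitSet H p) := by
  have key : ∀ w ∈ W, ∀ α ∈ limitSet H p, boundaryMap w α ∈ limitSet H p := by
    intro w hw α hα
    have h1 := hX.boundaryMap_mem_limitPoints w hα
    refine hX.limitPoints_subset (K := dist (w p) p) ?_ _ _ h1
    rintro _ ⟨_, ⟨γ, hγ, rfl⟩, rfl⟩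
    refine ⟨(w * γ * w⁻¹) p, ⟨_, h w hw γ hγ, rfl⟩, ?_⟩
    rw [dist_comm, ← IsometryEquiv.mul_apply, dist_apply_apply, dist_comm,
      show (w * γ)⁻¹ * (w * γ * w⁻¹) = w⁻¹ by group, ← w.dist_eq]
    simp
  intro w hw
  refine Set.Subset.antisymm ?_ fun α hα => ?_
  · rintro _ ⟨α, hα, rfl⟩
    exact key w hw α hα
  · refine ⟨_, key _ (inv_mem hw) α hα, ?_⟩
    obtain ⟨c, rfl⟩ : ∃ c : GeodesicRay X, c.endpoint = α := Quotient.exists_rep α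
    change GeodesicRay.endpoint (GeodesicRay.map w (GeodesicRay.map w⁻¹ c)) = _
    congr 1
    cases c
    simp only [GeodesicRay.map, GeodesicRay.mk.injEq]
    ext t
    simp

/-- If `H` has infinite index in `K`, then some ray towards the limit set of `K` moves away from the
orbit of `H` at unit speed. -/
theorem exists_escaping_ray (hP : IsProperAction W) (hHK : H ≤ K) (hK : K ≤ W)
    (hind : H.relIndex K = 0) (x : X) :
    ∃ c : GeodesicRay X, c.toFun 0 = x ∧ c.endpoint ∈ limitSet K x ∧
      ∀ u ∈ H, ∀ t : ℝ≥0, t ≤ dist (c.toFun t) (u x) := by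
  have hg : ∀ n : ℕ, ∃ g ∈ K, n ≤ dist x (g x) ∧ ∀ v ∈ H, dist x (g x) ≤ dist (g x) (v x) := by
    intro n
    obtain ⟨w, hw, hfar⟩ := hP.exists_far hHK hK hind x n
    -- Translating by the inverse of the nearest orbit element makes `x` itself the point of the
    -- `H`-orbit closest to `g x`.
    obtain ⟨u, hu, hmin⟩ := hP.exists_min_dist (hHK.trans hK) (w x) x
    have h1 : dist x ((u⁻¹ * w) x) = dist (w x) (u x) := by
      rw [dist_apply_apply, dist_comm]
    refine ⟨u⁻¹ * w, mul_mem (inv_mem (hHK hu)) hw, ?_, fun v hv => ?_⟩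
    · rw [h1]
      exact (hfar u hu).le
    · rw [h1, dist_apply_apply (u⁻¹ * w) v, ← mul_assoc, ← mul_inv_rev, ← dist_apply_apply]
      exact hmin _ (mul_mem hu hv)
  choose g hgK hgn hgmin using hg
  choose ξ hξ using fun n => hX.1 x (g n x)
  obtain ⟨c, h0, hlim⟩ := exists_limit_ray hξ hgn
  have hev : ∀ t : ℝ≥0, ∀ᶠ n in (Filter.hyperfilter ℕ : Filter ℕ), (t : ℝ) < dist x (g n x) := by
    intro t
    refine Filter.Eventually.filter_mono Nat.hyperfilter_le_atTop ?_
    filter_upwards [Filter.eventually_gt_atTop ⌈(t : ℝ)⌉₊] with n hn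
    exact (Nat.lt_of_ceil_lt hn).trans_le (hgn n)
  refine ⟨c, h0, ?_, fun u hu t => ?_⟩
  · rw [limitSet_eq_limitPoints, hX.endpoint_mem_limitPoints_iff h0]
    intro r _ ε hε
    obtain ⟨n, h1, h2⟩ := ((hev r).and (Metric.tendsto_nhds.1 (hlim r) ε hε)).exists
    exact ⟨_, ⟨g n, hgK n, rfl⟩, h1, ξ n, hξ n, h2⟩
  · refine ge_of_tendsto ((hlim t).dist tendsto_const_nhds) ?_
    filter_upwards [hev t] with n hn
    have h1 := (hξ n).dist_right ⟨t.coe_nonneg, hn.le⟩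
    have h2 := hgmin n u hu
    have h3 := dist_triangle_left (g n x) (u x) (ξ n t)
    -- The orbit point is at least `dist x (g n x)` from `g n x`, and `ξ n t` is only `dist x (g n
    -- x) - t` from it.
    linarith

end IsCAT0

end LimitSets

/-! ### Invariant limit sets and the direct product decomposition -/

section Main

variable {X : Type*} [MetricSpace X] {W : Subgroup (X ≃ᵢ X)} {x₀ : X} {S T : Set (X ≃ᵢ X)}

namespace IsCocompactDiscreteReflectionGroup

variable (hW : IsCocompactDiscreteReflectionGroup W)

include hW

/-- Rays towards the limit set of a parabolic subgroup stay close to its orbit. -/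
theorem exists_near_ray (hX : IsCAT0 X) (hx₀ : x₀ ∈ wallComplement W)
    (hS : IsFundamentalSet W x₀ S) :
    ∃ D : ℝ, ∀ T ⊆ S, ∀ c : GeodesicRay X, c.toFun 0 = x₀ →
      c.endpoint ∈ limitSet (parabolic T) x₀ →
      ∀ t, ∃ u ∈ parabolic T, dist (c.toFun t) (u x₀) ≤ D := by
  obtain ⟨D, hD0, hD⟩ := hW.exists_quasiconvex hX.1 hx₀
  have hN := hW.isInversionCocycle hX.1 hx₀ hS
  refine ⟨D + 1, fun T hT c hc hcl t => ?_⟩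
  rcases eq_zero_or_pos t with rfl | ht
  · exact ⟨1, one_mem _, by simp [hc]; positivity⟩
  · rw [limitSet_eq_limitPoints, hX.endpoint_mem_limitPoints_iff hc] at hcl
    obtain ⟨_, ⟨w, hw, rfl⟩, h1, ξ, hξ, h2⟩ := hcl t ht 1 one_pos
    obtain ⟨u, hu, h3⟩ := hD _ (hN.parabolic_le hT) (fun v hv => hN.subset_parabolic hT hv) w hw
      ξ hξ t ⟨t.2, h1.le⟩
    exact ⟨u, hu, by linarith [dist_triangle_left (c.toFun t) (u x₀) (ξ t)]⟩

/-- If the limit set of `W_T` is invariant under a simple reflection `s ∉ T`, then the elements of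
`T` commuting with `s` generate a subgroup of finite index of `W_T`. -/
theorem relIndex_commuting_ne_zero (hX : IsCAT0 X) (hx₀ : x₀ ∈ wallComplement W)
    (hS : IsFundamentalSet W x₀ S) (hT : T ⊆ S) {s : X ≃ᵢ X} (hs : s ∈ S) (hsT : s ∉ T)
    (hinv : boundaryMap s '' limitSet (parabolic T) x₀ ⊆ limitSet (parabolic T) x₀) :
    (parabolic {t ∈ T | s * t = t * s}).relIndex (parabolic T) ≠ 0 := by
  intro hind
  have := hW.properSpace hX.1 hx₀
  have hN := hW.isInversionCocycle hX.1 hx₀ hS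
  have hle := hN.parabolic_le hT
  obtain ⟨D, hD⟩ := hW.exists_near_ray hX hx₀ hS
  obtain ⟨c, hc, hcl, hesc⟩ := hX.exists_escaping_ray hW.2.1
    (Subgroup.closure_mono (Set.sep_subset _ _)) hle hind x₀
  -- The ray `s ∘ c` starts at `s x₀`; an asymptotic ray from `x₀` is needed to apply
  -- `exists_near_ray`.
  obtain ⟨c', hc', hcc'⟩ := hX.exists_ray x₀ (boundaryMap s c.endpoint)
  obtain ⟨K, hK⟩ := GeodesicRay.endpoint_eq_iff.1
    (show c'.endpoint = (c.map s).endpoint from hcc')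
  have hcl' : c'.endpoint ∈ limitSet (parabolic T) x₀ := hcc' ▸ hinv ⟨_, hcl, rfl⟩
  choose u hu hcu using fun n : ℕ => hD T hT c hc hcl n
  choose v hv hcv using fun n : ℕ => hD T hT c' hc' hcl' n
  have hsW := (hS.1 hs).1
  have hF := hW.2.1.finite_dist_le x₀ x₀ (D + K + D)
  have hf : ∀ n, (v n)⁻¹ * (s * u n) ∈ {γ | γ ∈ W ∧ dist (γ x₀) x₀ ≤ D + K + D} := by
    intro n
    refine ⟨mul_mem (inv_mem (hle (hv n))) (mul_mem hsW (hle (hu n))), ?_⟩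
    rw [← dist_apply_apply]
    have h1 : dist ((s * u n) x₀) (s (c.toFun n)) = dist (c.toFun n) (u n x₀) := by
      rw [IsometryEquiv.mul_apply, s.dist_eq, dist_comm]
    have h2 : dist (c'.toFun n) (s (c.toFun n)) ≤ K := hK n
    have h3 := dist_triangle4 ((s * u n) x₀) (s (c.toFun n)) (c'.toFun n) (v n x₀)
    rw [dist_comm (s (c.toFun n))] at h3
    linarith [hcu n, hcv n]
  have hmem : ∀ m n, (v n)⁻¹ * (s * u n) = (v m)⁻¹ * (s * u m) →
      u n * (u m)⁻¹ ∈ parabolic {t ∈ T | s * t = t * s} := by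
    intro m n h
    refine hN.mem_parabolic_commuting hT hs hsT (mul_mem (hu n) (inv_mem (hu m))) ?_
    have h1 : s * (u n * (u m)⁻¹) * s = v n * (v m)⁻¹ := by
      rw [inv_mul_eq_iff_eq_mul] at h
      calc s * (u n * (u m)⁻¹) * s = (s * u n) * (s * u m)⁻¹ := by
            rw [mul_inv_rev, hN.inv_eq hs]
            group
        _ = v n * (v m)⁻¹ := by
            rw [h]
            group
    rw [h1]
    exact mul_mem (hv n) (inv_mem (hv m))
  have := hF.to_subtype
  -- Pigeonhole: one value recurs for infinitely many `n`. With `m` fixed in this fibre and `n`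
  -- beyond `D + dist (u m x₀) x₀`, the ray is too close to the orbit it escapes from.
  obtain ⟨f, hfinf⟩ := Finite.exists_infinite_fiber
    (fun n => (⟨_, hf n⟩ : {γ | γ ∈ W ∧ dist (γ x₀) x₀ ≤ D + K + D}))
  have hinf := Set.infinite_coe_iff.1 hfinf
  obtain ⟨m, hm⟩ := hinf.nonempty
  obtain ⟨n, hn, hmn⟩ := hinf.exists_gt ⌈D + dist (u m x₀) x₀⌉₊
  have h1 := hmem m n (congrArg Subtype.val (hn.trans hm.symm))
  have h2 := hesc _ h1 n
  have h3 : dist (u n x₀) ((u n * (u m)⁻¹) x₀) = dist (u m x₀) x₀ := by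
    rw [IsometryEquiv.mul_apply, (u n).dist_eq, dist_comm, ← (u m).dist_eq, dist_comm]
    simp [dist_comm]
  have h4 := dist_triangle (c.toFun n) (u n x₀) ((u n * (u m)⁻¹) x₀)
  have h5 := Nat.lt_of_ceil_lt hmn
  rw [NNReal.coe_natCast] at h2
  linarith [hcu n]

/-- For `s ∉ T'`, the elements of `T'` commuting with `s` generate a subgroup of finite index in
W_T' and hence in W_T, so leastness makes them all of `T'`. -/
theorem isInternalDirectProduct_of_isInvariant (hX : IsCAT0 X) (hx₀ : x₀ ∈ wallComplement W)
    (hS : IsFundamentalSet W x₀ S) (hT : T ⊆ S) {T' : Set (X ≃ᵢ X)}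
    (hT' : IsEssentialSubset T T') (hinv : IsInvariant W (limitSet (parabolic T') x₀)) :
    IsInternalDirectProduct W (parabolic T') (parabolic (S \ T')) := by
  have hN := hW.isInversionCocycle hX.1 hx₀ hS
  have hT'S : T' ⊆ S := hT'.1.trans hT
  obtain ⟨⟨_, _, _, hfin⟩, hleast⟩ := hT'.2
  have hcomm : ∀ s ∈ S \ T', ∀ t ∈ T', s * t = t * s := by
    intro s hs t ht
    have h1 := hW.relIndex_commuting_ne_zero hX hx₀ hS hT'S hs.1 hs.2
      (hinv s (hS.1 hs.1).1).subset
    have hU : {t ∈ T' | s * t = t * s} ⊆ T' := Set.sep_subset _ _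
    have h2 := hleast ⟨_, hU.trans hT'.1, rfl, Subgroup.relIndex_ne_zero_trans h1 hfin⟩
    exact (hN.subset_of_parabolic_le hT'S (hU.trans hT'S) h2 ht).2
  refine ⟨?_, ?_, ?_⟩
  · rw [← Subgroup.closure_union, Set.union_sdiff_cancel hT'S]
    exact hW.parabolic_eq hX.1 hx₀ hS
  · rw [disjoint_iff, ← hN.parabolic_inter hT'S Set.sdiff_subset, Set.inter_sdiff_self]
    exact Subgroup.closure_empty
  · have h1 : parabolic T' ≤ Subgroup.centralizer (S \ T') := by
      rw [Subgroup.closure_le]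
      intro t ht
      exact Subgroup.mem_centralizer_iff.2 fun s hs => hcomm s hs t ht
    have h2 : parabolic (S \ T') ≤ Subgroup.centralizer (parabolic T') := by
      rw [Subgroup.closure_le]
      intro s hs
      exact Subgroup.mem_centralizer_iff.2 fun a ha =>
        (Subgroup.mem_centralizer_iff.1 (h1 ha) s hs).symm
    exact fun a ha b hb => Subgroup.mem_centralizer_iff.1 (h2 hb) a ha

end IsCocompactDiscreteReflectionGroup

theorem IsInternalDirectProduct.conj_mem {G : Type*} [Group G] {W A B : Subgroup G}
    (h : IsInternalDirectProduct W A B) : ∀ w ∈ W, ∀ a ∈ A, w * a * w⁻¹ ∈ A := by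
  have hA : W ≤ Subgroup.normalizer (A : Set G) := by
    rw [← h.1]
    refine sup_le Subgroup.le_normalizer fun b hb => ?_
    rw [Subgroup.mem_normalizer_iff]
    have hb' : ∀ a ∈ A, b * a * b⁻¹ = a := fun a ha => by
      rw [← h.2.2 a ha b hb, mul_inv_cancel_right]
    refine fun a => ⟨fun ha => by rwa [hb' a ha], fun ha => ?_⟩
    have h1 := hb' _ ha
    have h2 : b * a * b⁻¹ = a := by
      rwa [mul_left_inj, mul_right_inj] at h1
    rwa [h2] at ha
  exact fun w hw a ha => (Subgroup.mem_normalizer_iff.1 (hA hw) a).1 ha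

end Main

end CatReflection

theorem mainTheorem4 {X : Type*} [MetricSpace X] (hX : CatReflection.IsCAT0 X)
    (W : Subgroup (X ≃ᵢ X)) (hW : CatReflection.IsCocompactDiscreteReflectionGroup W)
    (x₀ : X) (hx₀ : x₀ ∈ CatReflection.wallComplement W)
    (S : Set (X ≃ᵢ X)) (hS : CatReflection.IsFundamentalSet W x₀ S)
    (T : Set (X ≃ᵢ X)) (hT : T ⊆ S) :
    (∃! T' : Set (X ≃ᵢ X), CatReflection.IsEssentialSubset T T') ∧
    ∀ T' : Set (X ≃ᵢ X), CatReflection.IsEssentialSubset T T' → ∀ p : X,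
      (CatReflection.IsInvariant W (CatReflection.limitSet (CatReflection.parabolic T) p) ↔
        CatReflection.IsInternalDirectProduct W
          (CatReflection.parabolic T') (CatReflection.parabolic (S \ T'))) := by
  have hN := hW.isInversionCocycle hX.1 hx₀ hS
  have := hW.properSpace hX.1 hx₀
  refine ⟨hN.existsUnique_isEssentialSubset (hW.finite_fundamentalSet hX.1 hx₀ hS) hT,
    fun T' hT' p => ?_⟩
  have hfin : (CatReflection.parabolic T').relIndex (CatReflection.parabolic T) ≠ 0 := by
    obtain ⟨_, _, _, h⟩ := hT'.2.1
    exact h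
  rw [hX.limitSet_eq_of_relIndex_ne_zero (Subgroup.closure_mono hT'.1) hfin p x₀]
  exact ⟨hW.isInternalDirectProduct_of_isInvariant hX hx₀ hS hT hT',
    fun h => hX.isInvariant_limitSet h.conj_mem x₀⟩
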